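/- Notation. A partition is strict if its parts are pairwise distinct, and odd if all its parts are odd; $\mathcal{SP}_n$ and $\mathcal{OP}_n$ are the sets of strict and of odd partitions of $n$ (for $n=0$ both consist of the empty partition), $\mathcal{SP}=\bigcup_n\mathcal{SP}_n$, $\ell(\lambda)$ is the number of parts of $\lambda$, and $x^{\downarrow k}=x(x-1)\cdots(x-k+1)$, $x^{\downarrow 0}=1$. For $\lambda\in\mathcal{SP}_n$ let $S(\lambda)=\{(i,j): 1\le i\le \ell(\lambda),\ i\le j\le\lambda_i+i-1\}$ be its shifted diagram, and let $g^\lambda$ be the number of sequences $\emptyset=\lambda^{(0)},\lambda^{(1)},\dots,\lambda^{(n)}=\lambda$ of strict partitions in which each $S(\lambda^{(i)})$ arises from $S(\lambda^{(i-1)})$ by adding exactly one box. The shifted Plancherel average of a function $\varphi$ on $\mathcal{SP}_n$ is $$\mathbb{E}_n[\varphi]=\sum_{\lambda\in\mathcal{SP}_n}\frac{2^{n-\ell(\lambda)}(g^\lambda)^2}{n!}\,\varphi(\lambda).$$ Let $\Gamma$ be the algebra of supersymmetric functions, i.e. the $\mathbb{Q}$-algebra of symmetric functions generated by the power sums $p_1,p_3,p_5,\dots$;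 for $f\in\Gamma$ and $\lambda\in\mathcal{SP}$ put $f(\lambda)=f(\lambda_1,\dots,\lambda_{\ell(\lambda)},0,0,\dots)$, and for an odd partition $\rho$ put $p_\rho=p_{\rho_1}p_{\rho_2}\cdots$. For $\lambda\in\mathcal{SP}$ with $l=\ell(\lambda)$, the Schur $P$-function $P_\lambda$ and the factorial Schur $P$-function $P^*_\lambda$ are given in $N\ge l$ variables by $$P_{\lambda|N}=\frac1{(N-l)!}\sum_{\omega\in S_N}\omega\Bigl(x_1^{\lambda_1}\cdots x_l^{\lambda_l}\prod_{\substack{1\le i\le l\\ i<j\le N}}\frac{x_i+x_j}{x_i-x_j}\Bigr),\qquad P^*_{\lambda|N}=\frac1{(N-l)!}\sum_{\omega\in S_N}\omega\Bigl(x_1^{\downarrow\lambda_1}\cdots x_l^{\downarrow\lambda_l}\prod_{\substack{1\le i\le l\\ i<j\le N}}\frac{x_i+x_j}{x_i-x_j}\Bigr),$$ where $S_N$ permutes the variables, and by $0$ in $N<l$ variables. Statement. The functions $P_\lambda$ and $P^*_\lambda$ lie in $\Gamma$, and there is exactly one linear isomorphism $\Psi:\Gamma\to\Gamma$ with $\Psi(P_\lambda)=P^*_\lambda$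 for all $\lambda\in\mathcal{SP}$. Put $\mathfrak{p}_\rho=\Psi(p_\rho)$ for every odd partition $\rho$. Then for all integers $k,n\ge 0$ and every $\rho\in\mathcal{OP}_k$, $$\mathbb{E}_n[\mathfrak{p}_\rho]=\delta_{\rho,(1^k)}\,n^{\downarrow k}.$$ In particular $\mathbb{E}_n[\mathfrak{p}_\rho]=0$ unless $\rho=(1^k)$. -/

import Mathlib

namespace ShiftedPlancherel

/-! ### Partitions, shifted diagrams, the shifted Plancherel measure

Partitions of `n` are Mathlib's `Nat.Partition n`; the strict ones are `Nat.Partition.distincts n`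
and the odd ones are `Nat.Partition.odds n`. -/

/-- The parts `λ₁ ≥ λ₂ ≥ ⋯ ≥ λ_l` of a partition, as a decreasing list. -/
def row {n : ℕ} (lam : n.Partition) : List ℕ :=
  lam.parts.sort (· ≥ ·)

/-- The `i`-th part of a partition, with `i` counted from `0`; it is `0` beyond the length. -/
def part {n : ℕ} (lam : n.Partition) (i : ℕ) : ℕ :=
  (row lam).getD i 0

/-- The length `ℓ(λ)` of a partition. -/
def len {n : ℕ} (lam : n.Partition) : ℕ :=
  lam.parts.card

/-- The shifted Young diagram
`S(λ) = {(i, j) | 1 ≤ i ≤ ℓ(λ), i ≤ j ≤ λ_i + i - 1}`, rows and columns counted from `1`. -/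
def shiftedDiagram {n : ℕ} (lam : n.Partition) : Set (ℕ × ℕ) :=
  {b | 1 ≤ b.1 ∧ b.1 ≤ len lam ∧ b.1 ≤ b.2 ∧ b.2 ≤ part lam (b.1 - 1) + b.1 - 1}

/-- Standard tableaux of shape `S(λ)`: sequences `∅ = λ⁽⁰⁾, λ⁽¹⁾, …, λ⁽ⁿ⁾ = λ` of strict
partitions, `λ⁽ⁱ⁾` of size `i`, in which every diagram arises from the preceding one by adding
exactly one box. -/
def standardTableaux {n : ℕ} (lam : n.Partition) :
    Set ((i : Fin (n + 1)) → Nat.Partition (i : ℕ)) :=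
  {c | (∀ i : Fin (n + 1), c i ∈ Nat.Partition.distincts (i : ℕ)) ∧
    c (Fin.last n) = lam ∧
    ∀ i : Fin n, ∃ b ∉ shiftedDiagram (c i.castSucc),
      shiftedDiagram (c i.succ) = insert b (shiftedDiagram (c i.castSucc))}

/-- The number `g^λ` of standard tableaux of shape `S(λ)`. -/
noncomputable def tableauCount {n : ℕ} (lam : n.Partition) : ℕ :=
  (standardTableaux lam).ncard

/-- The weight `2^(n - ℓ(λ)) (g^λ)² / n!` of a strict partition `λ` of `n` under the shifted
Plancherel measure. -/
noncomputable def shiftedPlancherel {n : ℕ} (lam : n.Partition) : ℚ :=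
  2 ^ (n - len lam) * (tableauCount lam : ℚ) ^ 2 / (n.factorial : ℚ)

/-- The shifted Plancherel average of a function on the strict partitions of `n`. -/
noncomputable def average (n : ℕ) (φ : n.Partition → ℚ) : ℚ :=
  ∑ lam ∈ Nat.Partition.distincts n, shiftedPlancherel lam * φ lam

/-! ### Supersymmetric functions -/

/-- Families `(F_N)` of polynomials, `F_N` in `N` variables, with rational coefficients. -/
abbrev PolyFamily : Type := (N : ℕ) → MvPolynomial (Fin N) ℚ

/-- A family is a symmetric function if each `F_N` is symmetric and
`F_{N+1}(x₁, …, x_N, 0) = F_N(x₁, …, x_N)`. -/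
def symmetricFunctions : Subalgebra ℚ PolyFamily where
  carrier := {F | (∀ N, (F N).IsSymmetric) ∧
    ∀ N, MvPolynomial.aeval (Fin.snoc (α := fun _ => MvPolynomial (Fin N) ℚ)
      (fun i => MvPolynomial.X i) 0) (F (N + 1)) = F N}
  mul_mem' := by
    rintro F G ⟨hF, hF'⟩ ⟨hG, hG'⟩
    exact ⟨fun N => (hF N).mul (hG N), fun N => by rw [Pi.mul_apply, map_mul, hF', hG', Pi.mul_apply]⟩
  add_mem' := by
    rintro F G ⟨hF, hF'⟩ ⟨hG, hG'⟩
    exact ⟨fun N => (hF N).add (hG N), fun N => by rw [Pi.add_apply, map_add, hF', hG', Pi.add_apply]⟩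
  algebraMap_mem' := by
    intro r
    refine ⟨fun N => ?_, fun N => ?_⟩
    · exact MvPolynomial.IsSymmetric.C r
    · simp [MvPolynomial.algebraMap_eq]

/-- The power sum `p_r = x₁^r + x₂^r + ⋯`. -/
noncomputable def powerSum (r : ℕ) : PolyFamily :=
  fun N => MvPolynomial.psum (Fin N) ℚ r

/-- The algebra `Γ` of supersymmetric functions, generated by `p₁, p₃, p₅, …`. -/
noncomputable def Gamma : Subalgebra ℚ PolyFamily :=
  Algebra.adjoin ℚ {F | ∃ m : ℕ, F = powerSum (2 * m + 1)}

/-- Supersymmetric functions are symmetric functions. -/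
theorem Gamma_le_symmetricFunctions : Gamma ≤ symmetricFunctions := by
  refine Algebra.adjoin_le ?_
  rintro F ⟨m, rfl⟩
  refine ⟨fun N => MvPolynomial.psum_isSymmetric _ _ _, fun N => ?_⟩
  simp [powerSum, MvPolynomial.psum, Fin.sum_univ_castSucc]

/-- The product `p_ρ = p_{ρ₁} p_{ρ₂} ⋯ p_{ρ_l}`. -/
noncomputable def powerSumProd {k : ℕ} (rho : k.Partition) : PolyFamily :=
  (rho.parts.map powerSum).prod

theorem powerSumProd_mem {k : ℕ} {rho : k.Partition} (h : rho ∈ Nat.Partition.odds k) :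
    powerSumProd rho ∈ Gamma := by
  refine Subalgebra.multiset_prod_mem _ ?_
  intro F hF
  obtain ⟨r, hr, rfl⟩ := Multiset.mem_map.1 hF
  have h1 : ∀ i ∈ rho.parts, ¬ Even i := by
    simpa [Nat.Partition.odds, Nat.Partition.restricted] using h
  obtain ⟨m, rfl⟩ := Nat.not_even_iff_odd.1 (h1 r hr)
  exact Algebra.subset_adjoin ⟨m, rfl⟩

/-- The value `F(λ) = F(λ₁, …, λ_l, 0, 0, …)`, that is `F_l(λ₁, …, λ_l)` with `l = ℓ(λ)`. -/
noncomputable def value (F : PolyFamily) {n : ℕ} (lam : n.Partition) : ℚ :=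
  MvPolynomial.eval (fun i : Fin (len lam) => (part lam i : ℚ)) (F (len lam))

/-! ### Schur `P`-functions and factorial Schur `P`-functions -/

/-- The variable `x_i` in the field of rational functions in `N` variables. -/
noncomputable def var {N : ℕ} (i : Fin N) : FractionRing (MvPolynomial (Fin N) ℚ) :=
  algebraMap (MvPolynomial (Fin N) ℚ) (FractionRing (MvPolynomial (Fin N) ℚ)) (MvPolynomial.X i)

/-- The rational function
`1/(N-l)! ∑_{ω ∈ S_N} ω( b(x₁, λ₁) ⋯ b(x_l, λ_l) ∏_{i ≤ l, i < j ≤ N} (x_i + x_j)/(x_i - x_j) )`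
for `l = ℓ(λ) ≤ N`, and `0` if `N < l`. The sum is a polynomial for the two choices of `b`
below. -/
noncomputable def symmetrization {n : ℕ} (lam : n.Partition) (N : ℕ)
    (b : FractionRing (MvPolynomial (Fin N) ℚ) → ℕ → FractionRing (MvPolynomial (Fin N) ℚ)) :
    FractionRing (MvPolynomial (Fin N) ℚ) :=
  if len lam ≤ N then
    (((N - len lam).factorial : ℕ) : FractionRing (MvPolynomial (Fin N) ℚ))⁻¹ *
      ∑ ω : Equiv.Perm (Fin N),
        (∏ i ∈ Finset.univ.filter (fun i : Fin N => (i : ℕ) < len lam), b (var (ω i)) (part lam i)) *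
        ∏ i ∈ Finset.univ.filter (fun i : Fin N => (i : ℕ) < len lam), ∏ j ∈ Finset.univ.filter (fun j : Fin N => i < j),
          (var (ω i) + var (ω j)) / (var (ω i) - var (ω j))
  else 0

/-- `F` is the Schur `P`-function `P_λ`. -/
def IsSchurP {n : ℕ} (lam : n.Partition) (F : PolyFamily) : Prop :=
  ∀ N, algebraMap (MvPolynomial (Fin N) ℚ) (FractionRing (MvPolynomial (Fin N) ℚ)) (F N) =
    symmetrization lam N fun x m => x ^ m

/-- `F` is the factorial Schur `P`-function `P*_λ`: the powers `x^m` are replaced by the falling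
powers `x (x - 1) ⋯ (x - m + 1)`. -/
def IsFactorialSchurP {n : ℕ} (lam : n.Partition) (F : PolyFamily) : Prop :=
  ∀ N, algebraMap (MvPolynomial (Fin N) ℚ) (FractionRing (MvPolynomial (Fin N) ℚ)) (F N) =
    symmetrization lam N fun x m => ∏ j ∈ Finset.range m, (x - j)

/-! ### The isomorphism `Ψ` and the functions `𝔭_ρ` -/

/-- For every strict partition `λ` the functions `P_λ` and `P*_λ` lie in `Γ`, and
`Ψ (P_λ) = P*_λ`. -/
def SendsSchurPToFactorial (Ψ : Gamma ≃ₗ[ℚ] Gamma) : Prop :=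
  ∀ (m : ℕ), ∀ lam ∈ Nat.Partition.distincts m, ∃ F G : Gamma,
    IsSchurP lam (F : PolyFamily) ∧ IsFactorialSchurP lam (G : PolyFamily) ∧ Ψ F = G

/-- The linear isomorphism `Ψ : Γ → Γ` with `Ψ (P_λ) = P*_λ` for all strict partitions `λ`. -/
noncomputable def Psi : Gamma ≃ₗ[ℚ] Gamma :=
  Classical.epsilon SendsSchurPToFactorial

/-- The supersymmetric function `𝔭_ρ = Ψ (p_ρ)` of an odd partition `ρ`. -/
noncomputable def frakP {k : ℕ} (rho : k.Partition) (h : rho ∈ Nat.Partition.odds k) : Gamma :=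
  Psi ⟨powerSumProd rho, powerSumProd_mem h⟩

end ShiftedPlancherel

namespace ShiftedPlancherel

/-! ### The ring of odd power sums and the insertion operator -/

open Finset.HasAntidiagonal (antidiagonal)

/-! Everything happens in `OddRing`, the polynomial ring on p_1, p_3, …, identified with Γ only at
the end. When f(0) = 0, `cons f` is the operator g ↦ ∑_i f(x_i) ∏_{j≠i} (x_i+x_j)/(x_i-x_j) g(x
without x_i). Composing these operators for the powers x^{λ_i} gives P_λ, and for the falling powers
P*_λ.

Existence and uniqueness of Ψ. A factorial function P*_λ vanishes at every strict μ ≠ λ with |μ| ≤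
|λ|, and P*_λ(λ) > 0. Hence the P*_λ are linearly independent, and Euler's theorem (as many strict
as odd partitions) makes them a basis compatible with degree (`degLT_eq_span`). So values at strict
partitions determine an element (`ext_evalNat`). Since P_λ - P*_λ has lower degree, P*_λ ↦ P_λ is
unipotent for the degree filtration, hence bijective; Ψ is its inverse `factorize`.

Averages. Write A + box for the strict partitions that cover A. Then p_1 P_A = ∑ P_{A+box} and p_1
P*_A = ∑ P*_{A+box} + |A| P*_A, while ∂/∂p_1 removes a box from P_A, with weight 1 if a row
disappears and 2 otherwise. The second rule, evaluated at a strict partition of n, gives ∑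
P*_{A+box} = (n - |A|) P*_A there. This yields g^λ P*_λ(λ) = n! for |λ| = n and, by induction on n -
k, E_n[P*_λ] = binom(n,k) 2^{k-ℓ(λ)} g^λ for |λ| = k (`plancherelAverage_factP`). The rule for
∂/∂p_1 identifies 2^{k-ℓ(λ)} g^λ with the constant term of (∂/∂p_1)^k P_λ. By linearity E_n[Ψ f] =
∑_j binom(n,j) [constant term of (∂/∂p_1)^j f] (`plancherelAverage_factorize`). For f = p_ρ the
constant term is j! if ρ = (1^j) and 0 otherwise, which leaves n(n-1)⋯(n-k+1) exactly for ρ = (1^k).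
-/

/-- The polynomial ring on generators `y_m`, which stand for the odd power sums `p_{2m+1}`. -/
abbrev OddRing : Type := MvPolynomial ℕ ℚ

/-- The generator that stands for `p_{2m+1}`. -/
noncomputable abbrev gen (m : ℕ) : OddRing := MvPolynomial.X m

/-- The coefficient of `t^i` in `p_1 + p_3 t^2 + p_5 t^4 + ⋯`. -/
noncomputable def oddCoeff (i : ℕ) : OddRing := if Even i then gen (i / 2) else 0

/-- The coefficient `q_r` of `t^r` in `∏ (1 + x_i t) / (1 - x_i t)`. -/
noncomputable def qFun : ℕ → OddRing
  | 0 => 1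
  | n + 1 => MvPolynomial.C (2 / (n + 1 : ℚ)) * ∑ j : Fin (n + 1), oddCoeff (n - j) * qFun j

theorem qFun_zero : qFun 0 = 1 := by rw [qFun]

/-- The coefficient of t^n in Q' = 2(p_1 + p_3 t² + ⋯) Q, the logarithmic derivative of Q = ∏ (1+x_i
t)/(1-x_i t). -/
theorem qFun_succ (n : ℕ) :
    ((n : OddRing) + 1) * qFun (n + 1) =
      2 * ∑ p ∈ antidiagonal n, oddCoeff p.1 * qFun p.2 := by
  rw [qFun, ← mul_assoc, ← Finset.Nat.sum_antidiagonal_swap,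
    Finset.Nat.sum_antidiagonal_eq_sum_range_succ_mk]
  simp only [Prod.swap]
  rw [Finset.sum_range (fun j => oddCoeff (n - j) * qFun j)]
  congr 1
  have h : ((n : ℚ) + 1) ≠ 0 := by positivity
  have h2 : ((n : OddRing) + 1) = MvPolynomial.C ((n : ℚ) + 1) := by simp
  rw [h2, ← MvPolynomial.C_mul, mul_div_cancel₀ _ h]
  exact map_ofNat MvPolynomial.C 2

theorem natCast_succ_ne_zero (n : ℕ) : (n : OddRing) + 1 ≠ 0 := by
  exact_mod_cast Nat.succ_ne_zero n

theorem qFun_one : qFun 1 = 2 * gen 0 := by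
  have h := qFun_succ 0
  simpa [oddCoeff, qFun_zero] using h

/-- The linear map on polynomials in `X` that replaces `X^r` by `q_r / 2`. -/
noncomputable def qSubst : Polynomial OddRing →ₗ[OddRing] OddRing :=
  Polynomial.lsum fun r => LinearMap.mulRight OddRing (MvPolynomial.C (1 / 2) * qFun r)

theorem qSubst_monomial (r : ℕ) (G : OddRing) :
    qSubst (Polynomial.monomial r G) = G * (MvPolynomial.C (1 / 2) * qFun r) := by
  simp [qSubst, Polynomial.lsum_apply, Polynomial.sum_monomial_index, mul_assoc]

/-- Removal of a variable `X`: the substitution `p_{2m+1} ↦ p_{2m+1} - X^{2m+1}`. -/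
noncomputable def removeVar : OddRing →ₐ[ℚ] Polynomial OddRing :=
  MvPolynomial.aeval fun m => Polynomial.C (gen m) - Polynomial.X ^ (2 * m + 1)

/-- The operator `g ↦ ∑_i f(x_i) ∏_{j ≠ i} (x_i + x_j) / (x_i - x_j) g(x without x_i)`. -/
noncomputable def cons : Polynomial ℚ →ₗ[ℚ] OddRing →ₗ[ℚ] OddRing :=
  LinearMap.mk₂ ℚ (fun f g => qSubst (f.map (algebraMap ℚ OddRing) * removeVar g))
    (fun f₁ f₂ g => by simp [add_mul])
    (fun c f g => by
      rw [Polynomial.map_smul, smul_mul_assoc, map_smul, algebraMap_smul])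
    (fun f g₁ g₂ => by simp [mul_add])
    (fun c f g => by
      rw [map_smul, mul_smul_comm, ← algebraMap_smul OddRing c, map_smul, algebraMap_smul])

theorem cons_apply (f : Polynomial ℚ) (g : OddRing) :
    cons f g = qSubst (f.map (algebraMap ℚ OddRing) * removeVar g) := rfl

theorem cons_X_pow_one (r : ℕ) :
    cons (Polynomial.X ^ r) 1 = MvPolynomial.C (1 / 2) * qFun r := by
  rw [cons_apply, map_one, mul_one, Polynomial.map_pow, Polynomial.map_X,
    ← Polynomial.monomial_one_right_eq_X_pow, qSubst_monomial, one_mul]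

/-- Removing X turns p_{2m+1} into p_{2m+1} - X^{2m+1}, and `qSubst` is linear over `OddRing`.
Together with the value at g = 1 this recursion determines `cons`, so it drives the inductions on g
below. -/
theorem cons_gen_mul (m : ℕ) (f : Polynomial ℚ) (g : OddRing) :
    cons f (gen m * g) = gen m * cons f g - cons (f * Polynomial.X ^ (2 * m + 1)) g := by
  have h : removeVar (gen m) = Polynomial.C (gen m) - Polynomial.X ^ (2 * m + 1) := by
    simp [removeVar]
  rw [cons_apply, cons_apply, cons_apply, map_mul removeVar, h, ← smul_eq_mul (gen m), ← map_smul,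
    ← map_sub]
  congr 1
  rw [Polynomial.smul_eq_C_mul, Polynomial.map_mul, Polynomial.map_pow, Polynomial.map_X]
  ring

theorem gen_zero_mul_cons (f : Polynomial ℚ) (g : OddRing) :
    gen 0 * cons f g = cons (f * Polynomial.X) g + cons f (gen 0 * g) := by
  rw [cons_gen_mul]; simp

theorem cons_X_one : cons Polynomial.X 1 = gen 0 := by
  have h := cons_X_pow_one 1
  rw [pow_one, qFun_one, ← mul_assoc] at h
  rw [h]
  have : (MvPolynomial.C (1 / 2) * 2 : OddRing) = 1 := by
    rw [← map_ofNat MvPolynomial.C 2, ← MvPolynomial.C_mul]; norm_num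
  rw [this, one_mul]

/-- A convention rather than an evaluation: in N variables ∑_i ∏_{j≠i} (x_i+x_j)/(x_i-x_j) is 0 or 1
according to the parity of N. The value q_0/2 = 1/2 is the one for which `dOne_cons` also holds at r
= 0. -/
theorem cons_one_one : cons 1 1 = MvPolynomial.C (1 / 2) := by
  have h := cons_X_pow_one 0
  rwa [pow_zero, qFun_zero, mul_one] at h

/-! ### The derivation ∂/∂p_1 on inserted variables -/

/-- The derivation `∂/∂p_1`. -/
noncomputable abbrev dOne : Derivation ℚ OddRing OddRing := MvPolynomial.pderiv 0

theorem dOne_gen (m : ℕ) : dOne (gen m) = if m = 0 then 1 else 0 := by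
  rcases eq_or_ne m 0 with rfl | h
  · simp
  · rw [if_neg h, MvPolynomial.pderiv_X_of_ne h]

theorem dOne_oddCoeff (i : ℕ) : dOne (oddCoeff i) = if i = 0 then 1 else 0 := by
  unfold oddCoeff
  rcases Nat.even_or_odd' i with ⟨c, rfl | rfl⟩
  · rw [if_pos (by simp), dOne_gen]
    simp
  · rw [if_neg (by simp)]
    simp

/-- The generating series is exp(2 ∑ p_{2m+1} t^{2m+1}/(2m+1)), so ∂/∂p_1 multiplies it by 2t. The
recursion `qFun_succ` replaces the exponential here. -/
theorem dOne_qFun_succ (r : ℕ) : dOne (qFun (r + 1)) = 2 * qFun r := by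
  induction r using Nat.strong_induction_on with
  | _ n ih =>
    have h := congrArg dOne (qFun_succ n)
    have e1 : dOne (((n : OddRing) + 1) * qFun (n + 1)) =
        ((n : OddRing) + 1) * dOne (qFun (n + 1)) := by
      rw [Derivation.leibniz, show ((n : OddRing) + 1) = ((n + 1 : ℕ) : OddRing) by push_cast; rfl,
        Derivation.map_natCast, smul_zero, add_zero, smul_eq_mul]
    have e2 : dOne (2 * ∑ p ∈ antidiagonal n, oddCoeff p.1 * qFun p.2) =
        2 * ∑ p ∈ antidiagonal n, dOne (oddCoeff p.1 * qFun p.2) := by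
      rw [two_mul, map_add, map_sum, two_mul]
    have e3 : ∑ p ∈ antidiagonal n, dOne (oddCoeff p.1 * qFun p.2) =
        qFun n + ∑ p ∈ antidiagonal n, oddCoeff p.1 * dOne (qFun p.2) := by
      simp only [Derivation.leibniz, smul_eq_mul, Finset.sum_add_distrib, dOne_oddCoeff]
      rw [add_comm]
      congr 1
      rw [Finset.sum_eq_single (0, n)]
      · simp
      · rintro ⟨i, j⟩ hij hne
        have : i ≠ 0 := by
          rintro rfl
          apply hne
          simpa using hij
        simp [this]
      · simp
    have e4 : ∑ p ∈ antidiagonal n, oddCoeff p.1 * dOne (qFun p.2) = n * qFun n := by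
      cases n with
      | zero => simp [qFun_zero]
      | succ n =>
        rw [Finset.Nat.sum_antidiagonal_succ']
        have : ∀ p ∈ antidiagonal n, oddCoeff p.1 * dOne (qFun (p.2 + 1)) =
            2 * (oddCoeff p.1 * qFun p.2) := by
          intro p hp
          rw [ih p.2 (by have := Finset.HasAntidiagonal.mem_antidiagonal.1 hp; omega)]
          ring
        rw [Finset.sum_congr rfl this, ← Finset.mul_sum, ← qFun_succ]
        simp [qFun_zero]
    rw [e1, e2, e3, e4] at h
    apply mul_left_cancel₀ (natCast_succ_ne_zero n)
    rw [h]; ring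

/-- ∂/∂p_1 commutes with p_1 ↦ p_1 - X, so the only extra term comes from differentiating q_{r+1}/2,
q_{r+2}/2, … after the substitution; this lowers the power of X by one and contributes a factor 2.
-/
theorem dOne_cons (r : ℕ) (g : OddRing) :
    dOne (cons (Polynomial.X ^ (r + 1)) g) =
      cons (Polynomial.X ^ (r + 1)) (dOne g) + 2 * cons (Polynomial.X ^ r) g := by
  induction g using MvPolynomial.induction_on generalizing r with
  | C a =>
    have e : ∀ k, cons (Polynomial.X ^ k) (MvPolynomial.C a) =
        MvPolynomial.C a * (MvPolynomial.C (1 / 2) * qFun k) := by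
      intro k
      have := (cons (Polynomial.X ^ k)).map_smul a 1
      rwa [cons_X_pow_one, MvPolynomial.smul_eq_C_mul, MvPolynomial.smul_eq_C_mul, mul_one] at this
    rw [e, e, MvPolynomial.pderiv_C_mul, MvPolynomial.pderiv_C_mul, MvPolynomial.pderiv_C, map_zero,
      dOne_qFun_succ]
    ring
  | add p q hp hq =>
    simp only [map_add, hp, hq]; ring
  | mul_X p m hp =>
    have e : ∀ k, cons (Polynomial.X ^ k) (p * gen m) =
        gen m * cons (Polynomial.X ^ k) p - cons (Polynomial.X ^ (k + 2 * m + 1)) p := by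
      intro k
      rw [mul_comm, cons_gen_mul, ← pow_add, add_assoc]
    have hd : dOne (p * gen m) = dOne (gen m) * p + dOne p * gen m := by
      rw [Derivation.leibniz]; simp only [smul_eq_mul]; ring
    have e' : cons (Polynomial.X ^ (r + 1)) (dOne p * gen m) =
        gen m * cons (Polynomial.X ^ (r + 1)) (dOne p) -
          cons (Polynomial.X ^ (r + 1 + 2 * m + 1)) (dOne p) := by
      rw [mul_comm, cons_gen_mul, ← pow_add, ← add_assoc]
    rw [hd, e, e, map_add, e', map_sub, Derivation.leibniz, hp,
      show r + 1 + 2 * m + 1 = (r + 1 + 2 * m) + 1 by ring, hp,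
      show r + 2 * m + 1 = r + 1 + 2 * m by ring]
    simp only [smul_eq_mul, dOne_gen]
    split_ifs
    · rw [one_mul]; ring
    · rw [zero_mul, map_zero]; ring

/-! ### Iterated insertion, multiplication by p_1 and ∂/∂p_1 -/

/-- The function attached to the polynomials `f_1, …, f_l`. -/
noncomputable def schur (fs : List (Polynomial ℚ)) : OddRing :=
  fs.foldr (fun f g => cons f g) 1

@[simp] theorem schur_nil : schur [] = 1 := rfl

@[simp] theorem schur_cons (f : Polynomial ℚ) (fs : List (Polynomial ℚ)) :
    schur (f :: fs) = cons f (schur fs) := rfl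

theorem schur_append_one (fs : List (Polynomial ℚ)) :
    schur (fs ++ [1]) = MvPolynomial.C (1 / 2) * schur fs := by
  induction fs with
  | nil => simp [cons_one_one]
  | cons f fs ih =>
    rw [List.cons_append, schur_cons, ih, schur_cons, ← MvPolynomial.smul_eq_C_mul,
      ← MvPolynomial.smul_eq_C_mul, map_smul]

theorem map_update_of_notMem {ι α : Type*} [DecidableEq ι] (f : ι → α) (a : α) {i : ι} {L : List ι}
    (h : i ∉ L) : L.map (Function.update f i a) = L.map f := by
  refine List.map_congr_left fun j hj => Function.update_of_ne ?_ _ _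
  rintro rfl; exact h hj

/-- Pushing p_1 inward past each insertion multiplies one entry by X at a time; at the end p_1 =
`cons X 1` becomes a new last entry. This is the raw Pieri rule. -/
theorem gen_zero_mul_schur {L : List ℕ} (hL : L.Nodup) (f : ℕ → Polynomial ℚ) :
    gen 0 * schur (L.map f) =
      (L.map fun i => schur (L.map (Function.update f i (f i * Polynomial.X)))).sum +
        schur (L.map f ++ [Polynomial.X]) := by
  induction L with
  | nil => simp [cons_X_one]
  | cons a L ih =>
    obtain ⟨ha, hL'⟩ := List.nodup_cons.1 hL
    rw [List.map_cons, schur_cons, gen_zero_mul_cons, ih hL']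
    simp only [List.map_cons, List.sum_cons, Function.update_self, List.cons_append, schur_cons,
      map_add, map_list_sum, List.map_map, map_update_of_notMem _ _ ha]
    rw [add_assoc]
    congr 3
    refine List.map_congr_left fun i hi => ?_
    have : a ≠ i := by rintro rfl; exact ha hi
    simp [Function.update_of_ne this]

theorem dOne_schur {L : List ℕ} (hL : L.Nodup) (e : ℕ → ℕ) (he : ∀ i ∈ L, e i ≠ 0) :
    dOne (schur (L.map fun i => Polynomial.X ^ e i)) =
      (L.map fun i => 2 * schur (L.map
        (Function.update (fun i => Polynomial.X ^ e i) i (Polynomial.X ^ (e i - 1))))).sum := by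
  induction L with
  | nil => simp
  | cons a L ih =>
    obtain ⟨ha, hL'⟩ := List.nodup_cons.1 hL
    obtain ⟨r, hr⟩ := Nat.exists_eq_succ_of_ne_zero (he a (by simp))
    have hr' : e a - 1 = r := by omega
    simp only [List.map_cons, List.sum_cons, Function.update_self, schur_cons,
      map_update_of_notMem _ _ ha]
    rw [hr', hr, Nat.succ_eq_add_one, dOne_cons, ih hL' fun i hi => he i (by simp [hi]), add_comm,
      map_list_sum, List.map_map]
    congr 2
    refine List.map_congr_left fun i hi => ?_
    have : a ≠ i := by rintro rfl; exact ha hi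
    simp only [Function.comp_apply, Function.update_of_ne this, hr, Nat.succ_eq_add_one]
    rw [← map_ofNat MvPolynomial.C 2, ← MvPolynomial.smul_eq_C_mul, map_smul,
      MvPolynomial.smul_eq_C_mul]

/-! ### The filtration by degree -/

/-- The product of generators indexed by a multiset. -/
noncomputable def genProd (M : Multiset ℕ) : OddRing := (M.map gen).prod

/-- The degree of `genProd M` in the variables. -/
def genDeg (M : Multiset ℕ) : ℕ := (M.map fun m => 2 * m + 1).sum

/-- The elements of degree less than `d` in the variables. -/
noncomputable def degLT (d : ℕ) : Submodule ℚ OddRing :=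
  Submodule.span ℚ (genProd '' {M | genDeg M < d})

theorem degLT_mono {d e : ℕ} (h : d ≤ e) : degLT d ≤ degLT e :=
  Submodule.span_mono (Set.image_mono fun _ (hM : genDeg _ < d) => lt_of_lt_of_le hM h)

theorem genProd_mem {M : Multiset ℕ} {d : ℕ} (h : genDeg M < d) : genProd M ∈ degLT d :=
  Submodule.subset_span ⟨M, h, rfl⟩

theorem genProd_cons (m : ℕ) (M : Multiset ℕ) : genProd (m ::ₘ M) = gen m * genProd M := by
  simp [genProd]

theorem genDeg_cons (m : ℕ) (M : Multiset ℕ) : genDeg (m ::ₘ M) = 2 * m + 1 + genDeg M := by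
  simp [genDeg]

theorem one_mem_degLT : (1 : OddRing) ∈ degLT 1 := by
  simpa [genProd] using genProd_mem (M := 0) (d := 1) (by simp [genDeg])

theorem gen_mul_mem (m : ℕ) {g : OddRing} {d : ℕ} (hg : g ∈ degLT d) :
    gen m * g ∈ degLT (2 * m + 1 + d) := by
  induction hg using Submodule.span_induction with
  | mem x hx =>
    obtain ⟨M, hM, rfl⟩ := hx
    rw [← genProd_cons]
    refine genProd_mem ?_
    rw [genDeg_cons]
    exact Nat.add_lt_add_left hM _
  | zero => simp
  | add x y _ _ hx hy => rw [mul_add]; exact add_mem hx hy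
  | smul c x _ hx => rw [mul_smul_comm]; exact Submodule.smul_mem _ _ hx

theorem degLT_zero : degLT 0 = ⊥ := by simp [degLT]

theorem qFun_mem (r : ℕ) : qFun r ∈ degLT (r + 1) := by
  induction r using Nat.strong_induction_on with
  | _ n ih =>
    cases n with
    | zero => rw [qFun_zero]; exact one_mem_degLT
    | succ n =>
      rw [qFun, ← MvPolynomial.smul_eq_C_mul]
      refine Submodule.smul_mem _ _ (Submodule.sum_mem _ fun j _ => ?_)
      have hj := ih j j.2
      unfold oddCoeff
      split_ifs with h
      · refine degLT_mono ?_ (gen_mul_mem _ hj)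
        have := j.2
        omega
      · simp

/-- The substitution p_{2m+1} ↦ p_{2m+1} - X^{2m+1} is homogeneous and q_r has degree r, so
inserting X^r raises the degree by at most r. -/
theorem cons_X_pow_mem (r : ℕ) {g : OddRing} {d : ℕ} (hg : g ∈ degLT d) :
    cons (Polynomial.X ^ r) g ∈ degLT (d + r) := by
  induction hg using Submodule.span_induction with
  | mem x hx =>
    obtain ⟨M, hM, rfl⟩ := hx
    refine degLT_mono (d := genDeg M + 1 + r) (by have : genDeg M < d := hM; omega) ?_
    clear hM
    induction M using Multiset.induction_on generalizing r with
    | empty =>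
      simp only [genProd, genDeg, Multiset.map_zero, Multiset.prod_zero, Multiset.sum_zero]
      rw [cons_X_pow_one, ← MvPolynomial.smul_eq_C_mul]
      exact degLT_mono (by omega) (Submodule.smul_mem _ _ (qFun_mem r))
    | cons m M ih =>
      rw [genProd_cons, genDeg_cons, cons_gen_mul, ← pow_add]
      refine sub_mem ?_ ?_
      · exact degLT_mono (by omega) (gen_mul_mem m (ih r))
      · exact degLT_mono (by omega) (ih (r + (2 * m + 1)))
  | zero => simp
  | add x y _ _ hx hy => rw [map_add]; exact add_mem hx hy
  | smul c x _ hx => rw [map_smul]; exact Submodule.smul_mem _ _ hx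

theorem cons_mem {f : Polynomial ℚ} {m : ℕ} (hf : f.natDegree ≤ m) {g : OddRing} {d : ℕ}
    (hg : g ∈ degLT d) : cons f g ∈ degLT (d + m) := by
  rw [f.as_sum_range_C_mul_X_pow, map_sum, LinearMap.sum_apply]
  refine Submodule.sum_mem _ fun i hi => ?_
  rw [← Polynomial.smul_eq_C_mul, map_smul, LinearMap.smul_apply]
  refine Submodule.smul_mem _ _ (degLT_mono ?_ (cons_X_pow_mem i hg))
  have := Finset.mem_range.1 hi
  omega

theorem mem_degLT_of (f : OddRing) : ∃ d, f ∈ degLT d := by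
  induction f using MvPolynomial.induction_on with
  | C a =>
    refine ⟨1, ?_⟩
    rw [← mul_one (MvPolynomial.C a), ← MvPolynomial.smul_eq_C_mul]
    exact Submodule.smul_mem _ _ one_mem_degLT
  | add p q hp hq =>
    obtain ⟨d, hp⟩ := hp
    obtain ⟨e, hq⟩ := hq
    exact ⟨max d e, add_mem (degLT_mono (le_max_left _ _) hp) (degLT_mono (le_max_right _ _) hq)⟩
  | mul_X p m hp =>
    obtain ⟨d, hp⟩ := hp
    exact ⟨_, by rw [mul_comm]; exact gen_mul_mem m hp⟩

theorem descPochhammer_natDegree_le (m : ℕ) : (descPochhammer ℚ m).natDegree ≤ m :=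
  (descPochhammer_natDegree ℚ m).le

theorem schur_descPochhammer_mem (L : List ℕ) :
    schur (L.map (descPochhammer ℚ)) ∈ degLT (L.sum + 1) := by
  induction L with
  | nil => simpa using one_mem_degLT
  | cons a L ih =>
    simp only [List.map_cons, schur_cons, List.sum_cons]
    exact degLT_mono (by omega) (cons_mem (descPochhammer_natDegree_le a) ih)

/-- Powers are exchanged for falling powers one entry at a time; each exchange lowers the degree
because both polynomials are monic of the same degree. This makes the change of basis unipotent. -/
theorem schur_X_pow_sub_mem (L : List ℕ) :
    schur (L.map fun m => Polynomial.X ^ m) - schur (L.map (descPochhammer ℚ)) ∈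
      degLT L.sum := by
  induction L with
  | nil => simp
  | cons a L ih =>
    simp only [List.map_cons, schur_cons, List.sum_cons]
    have e : cons (Polynomial.X ^ a) (schur (L.map fun m => Polynomial.X ^ m)) -
        cons (descPochhammer ℚ a) (schur (L.map (descPochhammer ℚ))) =
        cons (Polynomial.X ^ a) (schur (L.map fun m => Polynomial.X ^ m) -
          schur (L.map (descPochhammer ℚ))) +
        cons (Polynomial.X ^ a - descPochhammer ℚ a) (schur (L.map (descPochhammer ℚ))) := by
      simp only [map_sub, LinearMap.sub_apply]; abel
    rw [e]
    refine add_mem (degLT_mono (by omega) (cons_X_pow_mem a ih)) ?_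
    cases a with
    | zero => simp
    | succ a =>
      refine degLT_mono (d := L.sum + 1 + a) (by omega) (cons_mem ?_ (schur_descPochhammer_mem L))
      have h1 : (Polynomial.X ^ (a + 1) : Polynomial ℚ).degree =
          (descPochhammer ℚ (a + 1)).degree := by
        rw [Polynomial.degree_X_pow, Polynomial.degree_eq_natDegree
          (monic_descPochhammer ℚ (a + 1)).ne_zero, descPochhammer_natDegree]
      have h2 := Polynomial.degree_sub_lt_left h1 (by simp)
        (by rw [Polynomial.leadingCoeff_X_pow, (monic_descPochhammer ℚ (a + 1)).leadingCoeff])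
      rw [Polynomial.degree_X_pow] at h2
      rw [Polynomial.natDegree_le_iff_coeff_eq_zero]
      exact fun N hN => Polynomial.coeff_eq_zero_of_degree_lt
        (h2.trans_le (by exact_mod_cast hN))

/-! ### Evaluation on finite families of points -/

section Evaluation

variable {ι K : Type*} [Field K]

/-- The geometric series `1 / (1 - a t)`. -/
noncomputable def geom (a : K) : PowerSeries K := PowerSeries.mk fun n => a ^ n

theorem geom_mul (a : K) : geom a * (1 - PowerSeries.C a * PowerSeries.X) = 1 := by
  ext n
  cases n with
  | zero => simp [geom]
  | succ n =>
    rw [mul_sub, mul_one, ← mul_assoc, map_sub, PowerSeries.coeff_succ_mul_X,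
      mul_comm, PowerSeries.coeff_C_mul]
    simp [geom, pow_succ', PowerSeries.coeff_one]

theorem geom_mul_geom (a b : K) :
    PowerSeries.C (a - b) * (geom a * geom b) =
      PowerSeries.C a * geom a - PowerSeries.C b * geom b := by
  have ha := geom_mul a
  have hb := geom_mul b
  rw [map_sub]
  linear_combination (PowerSeries.C a * geom a) * hb - (PowerSeries.C b * geom b) * ha

theorem geom_add_geom_neg (a : K) : geom a + geom (-a) = 2 * (geom a * geom (-a)) := by
  have ha := geom_mul a
  have hb := geom_mul (-a)
  rw [map_neg] at hb
  linear_combination (-geom (-a)) * ha - geom a * hb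

theorem derivative_geom (a : K) :
    PowerSeries.derivative K (geom a) = PowerSeries.C a * geom a ^ 2 := by
  have ha := geom_mul a
  have h := congrArg (PowerSeries.derivative K) ha
  rw [Derivation.leibniz, map_sub, Derivation.map_one_eq_zero, Derivation.leibniz,
    PowerSeries.derivative_C, PowerSeries.derivative_X] at h
  simp only [smul_eq_mul] at h
  linear_combination geom a * h - PowerSeries.derivative K (geom a) * ha

/-- The series `∏ (1 + x_i t) / (1 - x_i t)`. -/
noncomputable def qSeries (A : Finset ι) (x : ι → K) : PowerSeries K :=
  ∏ i ∈ A, (2 * geom (x i) - 1)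

/-- Each factor has logarithmic derivative x/(1-xt) + x/(1+xt), in which only odd powers of x
survive. -/
theorem derivative_qSeries [DecidableEq ι] (A : Finset ι) (x : ι → K) :
    PowerSeries.derivative K (qSeries A x) =
      (∑ i ∈ A, PowerSeries.C (x i) * (geom (x i) + geom (-x i))) * qSeries A x := by
  induction A using Finset.induction_on with
  | empty => simp [qSeries]
  | insert c A hc ih =>
    have hd : PowerSeries.derivative K (2 * geom (x c) - 1) =
        2 * (PowerSeries.C (x c) * geom (x c) ^ 2) := by
      rw [map_sub, Derivation.map_one_eq_zero, two_mul, map_add, derivative_geom]; ring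
    have e : qSeries (insert c A) x = (2 * geom (x c) - 1) * qSeries A x := by
      simp [qSeries, Finset.prod_insert hc]
    rw [e, Derivation.leibniz, ih, hd, Finset.sum_insert hc]
    simp only [smul_eq_mul]
    have h := geom_add_geom_neg (x c)
    linear_combination PowerSeries.C (x c) * qSeries A x * h

/-- Evaluation of a supersymmetric function at the points `x_i`, `i ∈ A`. -/
noncomputable def evalOn [Algebra ℚ K] (A : Finset ι) (x : ι → K) : OddRing →ₐ[ℚ] K :=
  MvPolynomial.aeval fun m => ∑ i ∈ A, x i ^ (2 * m + 1)

theorem evalOn_gen [Algebra ℚ K] (A : Finset ι) (x : ι → K) (m : ℕ) :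
    evalOn A x (gen m) = ∑ i ∈ A, x i ^ (2 * m + 1) := by simp [evalOn]

theorem evalOn_oddCoeff [Algebra ℚ K] (A : Finset ι) (x : ι → K) (n : ℕ) :
    2 * evalOn A x (oddCoeff n) =
      PowerSeries.coeff n (∑ i ∈ A, PowerSeries.C (x i) * (geom (x i) + geom (-x i))) := by
  rw [map_sum]
  simp only [PowerSeries.coeff_C_mul, map_add, geom, PowerSeries.coeff_mk]
  unfold oddCoeff
  rcases Nat.even_or_odd' n with ⟨c, rfl | rfl⟩
  · rw [if_pos (by simp), evalOn_gen, Finset.mul_sum]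
    refine Finset.sum_congr rfl fun i _ => ?_
    rw [Even.neg_pow (by simp), show 2 * c / 2 = c by omega]
    ring
  · rw [if_neg (by simp)]
    refine Eq.symm ?_
    rw [map_zero, mul_zero]
    refine Finset.sum_eq_zero fun i _ => ?_
    rw [Odd.neg_pow (by simp)]
    ring

variable [DecidableEq ι]

/-- The factor `∏_{j ≠ i} (x_i + x_j) / (x_i - x_j)`. -/
noncomputable def crossFactor (A : Finset ι) (x : ι → K) (i : ι) : K :=
  ∏ j ∈ A.erase i, (x i + x j) / (x i - x j)

theorem crossFactor_insert {A : Finset ι} (x : ι → K) {c i : ι} (hc : c ∉ A) (hi : i ∈ A) :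
    crossFactor (insert c A) x i = (x i + x c) / (x i - x c) * crossFactor A x i := by
  have hne : c ≠ i := by rintro rfl; exact hc hi
  rw [crossFactor, Finset.erase_insert_of_ne hne, Finset.prod_insert, crossFactor]
  exact fun h => hc (Finset.mem_of_mem_erase h)

theorem crossFactor_insert_self {A : Finset ι} (x : ι → K) {c : ι} (hc : c ∉ A) :
    crossFactor (insert c A) x c = ∏ j ∈ A, (x c + x j) / (x c - x j) := by
  rw [crossFactor, Finset.erase_insert hc]

/-- Partial fractions of `∏ (c + x_j) / (c - x_j)`. -/
theorem prod_eq_sum_crossFactor (A : Finset ι) (x : ι → K) (hx : Set.InjOn x A) (c : K)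
    (hc : ∀ i ∈ A, c ≠ x i) :
    ∏ j ∈ A, (c + x j) / (c - x j) =
      (-1) ^ A.card + ∑ i ∈ A, 2 * crossFactor A x i * (c / (c - x i)) := by
  induction A using Finset.induction_on generalizing c with
  | empty => simp
  | insert b A hb ih =>
    have hxA : Set.InjOn x A := hx.mono (by simp)
    have hbne : ∀ i ∈ A, x b ≠ x i := fun i hi h => by
      have := hx (by simp) (by simp [hi]) h
      exact hb (this ▸ hi)
    have h1 := ih hxA c fun i hi => hc i (by simp [hi])
    have h2 := ih hxA (x b) hbne
    have hcb : c - x b ≠ 0 := sub_ne_zero.2 (hc b (by simp))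
    rw [Finset.prod_insert hb, Finset.sum_insert hb, Finset.card_insert_of_notMem hb,
      crossFactor_insert_self x hb, h1, h2]
    -- The product of two fractions with poles at x_b and x_i is separated in the variable c. Summed
    -- over i, the second part is the expansion `h2` at c = x_b, which accounts for the coefficient
    -- of c/(c - x_b).
    have e : ∀ i ∈ A, 2 * crossFactor (insert b A) x i * (c / (c - x i)) =
        (c + x b) / (c - x b) * (2 * crossFactor A x i * (c / (c - x i))) -
        2 * (c / (c - x b)) * (2 * crossFactor A x i * (x b / (x b - x i))) := by
      intro i hi
      have h3 : c - x i ≠ 0 := sub_ne_zero.2 (hc i (by simp [hi]))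
      have h4 : x b - x i ≠ 0 := sub_ne_zero.2 (hbne i hi)
      have h5 : x i - x b ≠ 0 := sub_ne_zero.2 (hbne i hi).symm
      rw [crossFactor_insert x hb hi]
      field_simp
      ring
    rw [Finset.sum_congr rfl e, Finset.sum_sub_distrib, ← Finset.mul_sum, ← Finset.mul_sum]
    field_simp
    ring

/-- Partial fractions of `∏ (1 + x_i t) / (1 - x_i t)`. -/
theorem qSeries_eq (A : Finset ι) (x : ι → K) (hx : Set.InjOn x A) :
    qSeries A x = PowerSeries.C ((-1) ^ A.card) +
      ∑ i ∈ A, PowerSeries.C (2 * crossFactor A x i) * geom (x i) := by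
  induction A using Finset.induction_on with
  | empty => simp [qSeries]
  | insert b A hb ih =>
    have hxA : Set.InjOn x A := hx.mono (by simp)
    have hbne : ∀ i ∈ A, x b ≠ x i := fun i hi h => by
      have := hx (by simp) (by simp [hi]) h
      exact hb (this ▸ hi)
    have e0 : qSeries (insert b A) x = (2 * geom (x b) - 1) * qSeries A x := by
      simp [qSeries, Finset.prod_insert hb]
    rw [e0, ih hxA, Finset.sum_insert hb, Finset.card_insert_of_notMem hb,
      crossFactor_insert_self x hb, prod_eq_sum_crossFactor A x hxA (x b) hbne]
    -- The same separation of poles, now for a product of two geometric series.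
    have e : ∀ i ∈ A, PowerSeries.C (2 * crossFactor (insert b A) x i) * geom (x i) =
        (2 * geom (x b) - 1) * (PowerSeries.C (2 * crossFactor A x i) * geom (x i)) -
        PowerSeries.C (2 * (2 * crossFactor A x i * (x b / (x b - x i)))) * geom (x b) := by
      intro i hi
      have h4 : x b - x i ≠ 0 := sub_ne_zero.2 (hbne i hi)
      have h5 : x i - x b ≠ 0 := sub_ne_zero.2 (hbne i hi).symm
      rw [crossFactor_insert x hb hi]
      have h := geom_mul_geom (x b) (x i)
      have h6 : geom (x b) * geom (x i) = PowerSeries.C ((x b - x i)⁻¹) *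
          (PowerSeries.C (x b) * geom (x b) - PowerSeries.C (x i) * geom (x i)) := by
        rw [← h, ← mul_assoc, ← map_mul, inv_mul_cancel₀ h4, map_one, one_mul]
      have h7 : (2 : PowerSeries K) = PowerSeries.C 2 := (map_ofNat PowerSeries.C 2).symm
      have h8 : (x i + x b) / (x i - x b) = 2 * -x i * (x b - x i)⁻¹ - 1 := by
        field_simp; ring
      have h9 : PowerSeries.C (2 * ((x i + x b) / (x i - x b) * crossFactor A x i)) =
          PowerSeries.C (2 * crossFactor A x i) *
            (2 * -PowerSeries.C (x i) * PowerSeries.C ((x b - x i)⁻¹) - 1) := by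
        rw [h8]; simp only [map_mul, map_sub, map_neg, map_one, h7]; ring
      rw [h9]
      simp only [div_eq_mul_inv, map_mul, ← h7]
      linear_combination (-4 * PowerSeries.C (crossFactor A x i)) * h6
    rw [Finset.sum_congr rfl e, Finset.sum_sub_distrib, ← Finset.mul_sum, ← Finset.sum_mul,
      ← map_sum, ← Finset.mul_sum]
    have h7 : (2 : PowerSeries K) = PowerSeries.C 2 := (map_ofNat PowerSeries.C 2).symm
    simp only [map_mul, map_add, map_pow, map_neg, map_one, ← h7]
    ring

variable [Algebra ℚ K]

/-- Both sides satisfy the recursion of the logarithmic derivative and start at 1. -/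
theorem evalOn_qFun (A : Finset ι) (x : ι → K) (n : ℕ) :
    evalOn A x (qFun n) = PowerSeries.coeff n (qSeries A x) := by
  have : CharZero K := algebraRat.charZero K
  induction n using Nat.strong_induction_on with
  | _ n ih =>
    cases n with
    | zero =>
      rw [qFun_zero, map_one, PowerSeries.coeff_zero_eq_constantCoeff_apply, qSeries, map_prod]
      refine (Finset.prod_eq_one fun i _ => ?_).symm
      rw [map_sub, map_mul, map_ofNat, map_one, ← PowerSeries.coeff_zero_eq_constantCoeff_apply,
        geom, PowerSeries.coeff_mk, pow_zero]
      norm_num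
    | succ n =>
      have h := congrArg (evalOn A x) (qFun_succ n)
      have h' := congrArg (PowerSeries.coeff n) (derivative_qSeries A x)
      rw [PowerSeries.coeff_derivative, PowerSeries.coeff_mul] at h'
      simp only [map_mul, map_sum, map_add, map_natCast, map_one, map_ofNat] at h
      have h0 : (n : K) + 1 ≠ 0 := by exact_mod_cast Nat.succ_ne_zero n
      apply mul_left_cancel₀ h0
      rw [h, mul_comm _ (PowerSeries.coeff (n + 1) _), h', Finset.mul_sum]
      refine Finset.sum_congr rfl fun p hp => ?_
      have := Finset.HasAntidiagonal.mem_antidiagonal.1 hp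
      rw [ih p.2 (by omega), ← evalOn_oddCoeff]
      ring

/-- For constant g this is the coefficient of t^r in the partial fractions of `qSeries`; r ≠ 0
discards the constant (-1)^|A|. Multiplication of g by a generator matches `cons_gen_mul`, since
erasing i subtracts x_i^{2m+1} from the power sum. -/
theorem evalOn_cons_X_pow (A : Finset ι) (x : ι → K) (hx : Set.InjOn x A) {r : ℕ} (hr : r ≠ 0)
    (g : OddRing) :
    evalOn A x (cons (Polynomial.X ^ r) g) =
      ∑ i ∈ A, x i ^ r * crossFactor A x i * evalOn (A.erase i) x g := by
  have : CharZero K := algebraRat.charZero K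
  induction g using MvPolynomial.induction_on generalizing r with
  | C a =>
    have e : cons (Polynomial.X ^ r) (MvPolynomial.C a) =
        MvPolynomial.C a * (MvPolynomial.C (1 / 2) * qFun r) := by
      have := (cons (Polynomial.X ^ r)).map_smul a 1
      rwa [cons_X_pow_one, MvPolynomial.smul_eq_C_mul, MvPolynomial.smul_eq_C_mul, mul_one] at this
    have hC : ∀ (B : Finset ι) (c : ℚ), evalOn B x (MvPolynomial.C c) = algebraMap ℚ K c :=
      fun B c => by simp [evalOn]
    rw [e, map_mul, map_mul, hC, hC, evalOn_qFun, qSeries_eq A x hx, map_add, map_sum,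
      PowerSeries.coeff_C, if_neg hr, zero_add, Finset.mul_sum, Finset.mul_sum]
    refine Finset.sum_congr rfl fun i _ => ?_
    rw [PowerSeries.coeff_C_mul, geom, PowerSeries.coeff_mk, hC, map_div₀, map_one, map_ofNat]
    field_simp
  | add p q hp hq =>
    simp only [map_add, hp hr, hq hr, mul_add, Finset.sum_add_distrib]
  | mul_X p m hp =>
    rw [mul_comm, cons_gen_mul, ← pow_add, map_sub, map_mul, hp hr, hp (by omega), Finset.mul_sum,
      ← Finset.sum_sub_distrib]
    refine Finset.sum_congr rfl fun i hi => ?_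
    rw [map_mul, evalOn_gen, evalOn_gen, Finset.sum_erase_eq_sub hi]
    ring

theorem evalOn_cons (A : Finset ι) (x : ι → K) (hx : Set.InjOn x A) {f : Polynomial ℚ}
    (hf : f.coeff 0 = 0) (g : OddRing) :
    evalOn A x (cons f g) =
      ∑ i ∈ A, Polynomial.aeval (x i) f * crossFactor A x i * evalOn (A.erase i) x g := by
  have e : f = f.sum fun n a => a • Polynomial.X ^ n := by
    conv_lhs => rw [← Polynomial.sum_monomial_eq f]
    simp only [← Polynomial.smul_X_eq_monomial]
  have e' : ∀ i, Polynomial.aeval (x i) f = f.sum fun n a => algebraMap ℚ K a * x i ^ n := fun i => by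
    rw [Polynomial.aeval_def, Polynomial.eval₂_eq_sum]
  conv_lhs => rw [e]
  simp only [e', Polynomial.sum_def, map_sum, map_smul, LinearMap.sum_apply, LinearMap.smul_apply,
    Finset.sum_mul]
  rw [Finset.sum_comm]
  refine Finset.sum_congr rfl fun n hn => ?_
  have hn0 : n ≠ 0 := by rintro rfl; exact Polynomial.mem_support_iff.1 hn hf
  rw [evalOn_cons_X_pow A x hx hn0, Algebra.smul_def, Finset.mul_sum]
  refine Finset.sum_congr rfl fun i _ => ?_
  ring

/-- Two equal entries cancel. -/
theorem evalOn_cons_cons (A : Finset ι) (x : ι → K) (hx : Set.InjOn x A) {f : Polynomial ℚ}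
    (hf : f.coeff 0 = 0) (g : OddRing) : evalOn A x (cons f (cons f g)) = 0 := by
  have : CharZero K := algebraRat.charZero K
  let F : ι → ι → K := fun i j => Polynomial.aeval (x i) f * crossFactor A x i *
    (Polynomial.aeval (x j) f * crossFactor (A.erase i) x j * evalOn ((A.erase i).erase j) x g)
  have e : evalOn A x (cons f (cons f g)) = ∑ i ∈ A, ∑ j ∈ A, if i = j then 0 else F i j := by
    rw [evalOn_cons A x hx hf]
    refine Finset.sum_congr rfl fun i hi => ?_
    rw [evalOn_cons _ x (hx.mono (by simp)) hf, Finset.mul_sum]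
    rw [← Finset.add_sum_erase A _ hi, if_pos rfl, zero_add]
    refine Finset.sum_congr rfl fun j hj => ?_
    rw [if_neg (Finset.ne_of_mem_erase hj).symm]
  -- Exchanging the two chosen points changes only the sign of (x_i+x_j)/(x_i-x_j).
  have anti : ∀ i ∈ A, ∀ j ∈ A, (if i = j then 0 else F i j) = -(if j = i then 0 else F j i) := by
    intro i hi j hj
    rcases eq_or_ne i j with rfl | hij
    · simp
    · rw [if_neg hij, if_neg hij.symm]
      have h1 : ∀ a b, a ∈ A → b ∈ A → a ≠ b → crossFactor A x a =
          (x a + x b) / (x a - x b) * ∏ k ∈ (A.erase a).erase b, (x a + x k) / (x a - x k) := by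
        intro a b _ hb hab
        rw [crossFactor, ← Finset.mul_prod_erase _ _ (Finset.mem_erase.2 ⟨hab.symm, hb⟩)]
      have hne : x i - x j ≠ 0 := sub_ne_zero.2 fun h => hij (hx hi hj h)
      have hne' : x j - x i ≠ 0 := sub_ne_zero.2 fun h => hij (hx hi hj h.symm)
      simp only [F]
      rw [h1 i j hi hj hij, h1 j i hj hi hij.symm, Finset.erase_right_comm (a := j) (b := i)]
      simp only [crossFactor]
      rw [Finset.erase_right_comm (a := j) (b := i)]
      have : (x j + x i) / (x j - x i) = -((x i + x j) / (x i - x j)) := by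
        field_simp; ring
      rw [this]
      ring
  have h2 : evalOn A x (cons f (cons f g)) = -evalOn A x (cons f (cons f g)) := by
    rw [e]
    conv_rhs => rw [Finset.sum_comm]
    simp only [← Finset.sum_neg_distrib]
    exact Finset.sum_congr rfl fun i hi => Finset.sum_congr rfl fun j hj => anti i hi j hj
  exact self_eq_neg.1 h2

end Evaluation

/-! ### Strict partitions as finite sets of positive integers -/

/-- The elements of a finite set in decreasing order. -/
def decr (A : Finset ℕ) : List ℕ := A.sort (· ≥ ·)

theorem decr_pairwise (A : Finset ℕ) : (decr A).Pairwise (· > ·) :=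
  (Finset.sortedGT_sort A).pairwise

theorem mem_decr {A : Finset ℕ} {i : ℕ} : i ∈ decr A ↔ i ∈ A := Finset.mem_sort _

theorem decr_nodup (A : Finset ℕ) : (decr A).Nodup := Finset.sort_nodup _ _

theorem decr_toFinset (A : Finset ℕ) : (decr A).toFinset = A := Finset.sort_toFinset _ _

theorem decr_eq_of_pairwise {A : Finset ℕ} {L : List ℕ} (hL : L.Pairwise (· > ·))
    (h : ∀ i, i ∈ L ↔ i ∈ A) : decr A = L := by
  have hA : A = L.toFinset := by ext i; simp [h]
  rw [decr, hA, List.toFinset_sort (· ≥ ·) (hL.imp fun h => (ne_of_lt h).symm)]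
  exact hL.imp fun h => le_of_lt h

theorem decr_sum (A : Finset ℕ) : (decr A).sum = ∑ i ∈ A, i := by
  rw [← Multiset.sum_coe, decr, Finset.sort_eq]
  exact (congrArg Multiset.sum (Multiset.map_id A.1)).symm

/-! ### Vanishing of factorial functions at strict partitions -/

/-- The Schur `P`-function of a strict partition. -/
noncomputable def schurP (A : Finset ℕ) : OddRing :=
  schur ((decr A).map fun m => Polynomial.X ^ m)

/-- The factorial Schur `P`-function of a strict partition. -/
noncomputable def factP (A : Finset ℕ) : OddRing :=
  schur ((decr A).map (descPochhammer ℚ))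

/-- Evaluation at a strict partition. -/
noncomputable abbrev evalNat (A : Finset ℕ) : OddRing →ₐ[ℚ] ℚ := evalOn A (Nat.cast : ℕ → ℚ)

theorem descPochhammer_coeff_zero {m : ℕ} (hm : m ≠ 0) : (descPochhammer ℚ m).coeff 0 = 0 := by
  rw [Polynomial.coeff_zero_eq_eval_zero, descPochhammer_ne_zero_eval_zero ℚ hm]

theorem aeval_descPochhammer (a m : ℕ) :
    Polynomial.aeval (a : ℚ) (descPochhammer ℚ m) = (a.descFactorial m : ℚ) := by
  rw [Polynomial.coe_aeval_eq_eval, descPochhammer_eval_eq_descFactorial]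

theorem evalNat_cons_descPochhammer (A : Finset ℕ) {m : ℕ} (hm : m ≠ 0) (g : OddRing) :
    evalNat A (cons (descPochhammer ℚ m) g) =
      ∑ a ∈ A, (a.descFactorial m : ℚ) * crossFactor A Nat.cast a * evalNat (A.erase a) g := by
  rw [evalNat, evalOn_cons A _ Nat.cast_injective.injOn (descPochhammer_coeff_zero hm)]
  simp only [aeval_descPochhammer]

/-- A nonzero term of the expanded insertions assigns to each entry m of L its own element a of A;
the falling factorial of a forces m ≤ a. Equality of the sums forces every m = a and leaves nothing
over. -/
theorem sum_le_of_evalNat_ne_zero {L : List ℕ} (hL : ∀ i ∈ L, i ≠ 0) {A : Finset ℕ} (hA : 0 ∉ A)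
    (h : evalNat A (schur (L.map (descPochhammer ℚ))) ≠ 0) :
    L.sum ≤ ∑ i ∈ A, i ∧ (L.sum = ∑ i ∈ A, i → L.toFinset = A) := by
  induction L generalizing A with
  | nil =>
    refine ⟨by simp, fun h => ?_⟩
    have h := (Finset.sum_eq_zero_iff.1 h.symm)
    refine (Finset.eq_empty_of_forall_notMem fun i hi => hA ?_).symm
    rwa [← h i hi]
  | cons m L ih =>
    rw [List.map_cons, schur_cons, evalNat_cons_descPochhammer A (hL m (by simp))] at h
    obtain ⟨a, ha, hne⟩ := Finset.exists_ne_zero_of_sum_ne_zero h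
    have h1 := right_ne_zero_of_mul hne
    have h2 : a.descFactorial m ≠ 0 := by
      have := left_ne_zero_of_mul (left_ne_zero_of_mul hne)
      exact_mod_cast this
    have h3 : m ≤ a := by
      by_contra hlt
      exact h2 (Nat.descFactorial_eq_zero_iff_lt.2 (not_le.1 hlt))
    obtain ⟨h4, h5⟩ := ih (fun i hi => hL i (by simp [hi]))
      (fun h => hA (Finset.mem_of_mem_erase h)) h1
    have h6 := Finset.add_sum_erase A (fun i => i) ha
    rw [List.sum_cons]
    refine ⟨by omega, fun h7 => ?_⟩
    have hma : m = a := by omega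
    rw [List.toFinset_cons, h5 (by omega), hma, Finset.insert_erase ha]

/-- Only the identity assignment survives: the largest entry has nonzero falling factorial at itself
alone, and so on downwards. The remaining factors (m+j)/(m-j) with m > j are positive. -/
theorem evalNat_toFinset_pos {L : List ℕ} (hL : ∀ i ∈ L, i ≠ 0) (h : L.Pairwise (· > ·)) :
    0 < evalNat L.toFinset (schur (L.map (descPochhammer ℚ))) := by
  induction L with
  | nil => simp
  | cons m L ih =>
    obtain ⟨hm, hP⟩ := List.pairwise_cons.1 h
    have hmL : m ∉ L.toFinset := fun hmem => lt_irrefl _ (hm m (List.mem_toFinset.1 hmem))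
    have ih' := ih (fun i hi => hL i (by simp [hi])) hP
    rw [List.map_cons, schur_cons, evalNat_cons_descPochhammer _ (hL m (by simp)),
      List.toFinset_cons, Finset.sum_eq_single m]
    · rw [Finset.erase_insert hmL, crossFactor_insert_self _ hmL]
      refine mul_pos (mul_pos ?_ (Finset.prod_pos fun j hj => ?_)) ih'
      · exact_mod_cast Nat.pos_of_ne_zero fun h =>
          lt_irrefl _ (Nat.descFactorial_eq_zero_iff_lt.1 h)
      · have : (j : ℚ) < m := by exact_mod_cast hm j (List.mem_toFinset.1 hj)
        have hj0 : (0 : ℚ) ≤ j := by positivity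
        exact div_pos (by linarith) (by linarith)
    · intro b hb hbm
      have hb' : b ∈ L := by simpa [hbm] using hb
      rw [Nat.descFactorial_eq_zero_iff_lt.2 (hm b hb')]
      simp
    · simp

theorem evalNat_factP_of_le {A B : Finset ℕ} (hA : 0 ∉ A) (hB : 0 ∉ B)
    (h : ∑ i ∈ B, i ≤ ∑ i ∈ A, i) (hne : A ≠ B) : evalNat B (factP A) = 0 := by
  by_contra h0
  obtain ⟨h1, h2⟩ := sum_le_of_evalNat_ne_zero (L := decr A)
    (fun i hi => by rintro rfl; exact hA (mem_decr.1 hi)) hB h0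
  rw [decr_sum] at h1 h2
  exact hne ((decr_toFinset A).symm.trans (h2 (le_antisymm h1 h)))

theorem evalNat_factP_self_pos {A : Finset ℕ} (hA : 0 ∉ A) : 0 < evalNat A (factP A) := by
  have h := evalNat_toFinset_pos (L := decr A)
    (fun i hi => by rintro rfl; exact hA (mem_decr.1 hi)) (decr_pairwise A)
  rwa [decr_toFinset] at h

/-! ### The basis of factorial functions -/

/-- Strict partitions of arbitrary size. -/
abbrev StrictSet : Type := {A : Finset ℕ // 0 ∉ A}

theorem linearIndependent_evalNat_factP :
    LinearIndependent ℚ fun (A : StrictSet) (B : StrictSet) => evalNat B.1 (factP A.1) := by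
  rw [linearIndependent_iff']
  intro s g hg
  by_contra! hne
  obtain ⟨A₀, hA₀, hg₀⟩ := hne
  -- Evaluation at a smallest partition A in the relation kills every other term by the vanishing
  -- property.
  obtain ⟨A, hA, hmin⟩ := Finset.exists_min_image (s.filter fun A => g A ≠ 0)
    (fun A => ∑ i ∈ A.1, i) ⟨A₀, by simp [hA₀, hg₀]⟩
  obtain ⟨hAs, hgA⟩ := Finset.mem_filter.1 hA
  have h := congrFun hg A
  rw [Finset.sum_apply, Finset.sum_eq_single A] at h
  · simp only [Pi.smul_apply, smul_eq_mul, Pi.zero_apply] at h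
    exact mul_ne_zero hgA (evalNat_factP_self_pos A.2).ne' h
  · intro B hB hBA
    by_cases hgB : g B = 0
    · simp [hgB]
    · have := hmin B (by simp [hB, hgB])
      simp only [Pi.smul_apply, smul_eq_mul]
      rw [evalNat_factP_of_le B.2 A.2 this (fun h => hBA (Subtype.ext h)), mul_zero]
  · exact fun h => absurd hAs h

/-- The evaluations at all strict partitions. -/
noncomputable def evalAll : OddRing →ₗ[ℚ] (StrictSet → ℚ) :=
  LinearMap.pi fun B => (evalNat B.1).toLinearMap

theorem linearIndependent_factP : LinearIndependent ℚ fun A : StrictSet => factP A.1 :=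
  LinearIndependent.of_comp evalAll linearIndependent_evalNat_factP

/-- The strict partitions of `n`. -/
def strictSets (n : ℕ) : Finset (Finset ℕ) :=
  (Finset.range (n + 1)).powerset.filter fun A => 0 ∉ A ∧ ∑ i ∈ A, i = n

theorem mem_strictSets {n : ℕ} {A : Finset ℕ} : A ∈ strictSets n ↔ 0 ∉ A ∧ ∑ i ∈ A, i = n := by
  rw [strictSets, Finset.mem_filter, and_iff_right_iff_imp, Finset.mem_powerset]
  rintro ⟨-, rfl⟩ i hi
  rw [Finset.mem_range, Nat.lt_succ_iff]
  exact Finset.single_le_sum (f := fun i => i) (fun _ _ => Nat.zero_le _) hi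

theorem mem_distincts {n : ℕ} {lam : n.Partition} :
    lam ∈ Nat.Partition.distincts n ↔ lam.parts.Nodup := by simp [Nat.Partition.distincts]

theorem toFinset_mem_strictSets {n : ℕ} {lam : n.Partition}
    (h : lam ∈ Nat.Partition.distincts n) : lam.parts.toFinset ∈ strictSets n := by
  rw [mem_strictSets]
  refine ⟨fun h0 => lt_irrefl 0 (lam.parts_pos (Multiset.mem_toFinset.1 h0)), ?_⟩
  have := lam.parts_sum
  rw [Finset.sum, Multiset.toFinset_val, (mem_distincts.1 h).dedup]
  simpa using this

/-- The partition with a given set of parts. -/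
def ofStrictSet {n : ℕ} {A : Finset ℕ} (h : A ∈ strictSets n) : n.Partition where
  parts := A.1
  parts_pos := fun {i} hi => Nat.pos_of_ne_zero fun h0 => (mem_strictSets.1 h).1 (h0 ▸ hi)
  parts_sum := by
    rw [← (mem_strictSets.1 h).2, Finset.sum]; simp

theorem ofStrictSet_mem {n : ℕ} {A : Finset ℕ} (h : A ∈ strictSets n) :
    ofStrictSet h ∈ Nat.Partition.distincts n := mem_distincts.2 A.2

theorem ofStrictSet_toFinset {n : ℕ} {A : Finset ℕ} (h : A ∈ strictSets n) :
    (ofStrictSet h).parts.toFinset = A := Finset.val_toFinset A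

theorem toFinset_injOn {n : ℕ} {lam mu : n.Partition} (hl : lam ∈ Nat.Partition.distincts n)
    (hm : mu ∈ Nat.Partition.distincts n) (h : lam.parts.toFinset = mu.parts.toFinset) :
    lam = mu := by
  have := congrArg Finset.val h
  rw [Multiset.toFinset_val, Multiset.toFinset_val, (mem_distincts.1 hl).dedup,
    (mem_distincts.1 hm).dedup] at this
  exact Nat.Partition.ext this

theorem sum_distincts {M : Type*} [AddCommMonoid M] (n : ℕ) (F : Finset ℕ → M) :
    ∑ lam ∈ Nat.Partition.distincts n, F lam.parts.toFinset = ∑ A ∈ strictSets n, F A :=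
  Finset.sum_bij (fun lam _ => lam.parts.toFinset) (fun _ h => toFinset_mem_strictSets h)
    (fun _ h₁ _ h₂ h => toFinset_injOn h₁ h₂ h)
    (fun _ h => ⟨ofStrictSet h, ofStrictSet_mem h, ofStrictSet_toFinset h⟩) (fun _ _ => rfl)

/-- Euler's theorem, which supplies the dimension count for the basis. -/
theorem card_strictSets (n : ℕ) : (strictSets n).card = (Nat.Partition.odds n).card := by
  rw [Nat.Partition.card_odds_eq_card_distincts, Finset.card_eq_sum_ones, ← sum_distincts,
    Finset.card_eq_sum_ones]

/-- The odd partition whose parts are indexed by a multiset of generators. -/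
def oddPartition (M : Multiset ℕ) : (genDeg M).Partition where
  parts := M.map fun m => 2 * m + 1
  parts_pos := fun {i} hi => by
    obtain ⟨m, -, rfl⟩ := Multiset.mem_map.1 hi
    omega
  parts_sum := rfl

theorem oddPartition_mem (M : Multiset ℕ) : oddPartition M ∈ Nat.Partition.odds (genDeg M) := by
  simp only [Nat.Partition.odds, Nat.Partition.restricted, Finset.mem_filter, Finset.mem_univ,
    true_and, oddPartition]
  intro i hi
  obtain ⟨m, -, rfl⟩ := Multiset.mem_map.1 hi
  simp

/-- A finite spanning set of `degLT d`. -/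
noncomputable def degSpan (d : ℕ) : Finset OddRing :=
  ((Finset.range d).sigma fun j => Nat.Partition.odds j).image
    fun p => genProd (p.2.parts.map fun r => r / 2)

theorem genProd_mem_degSpan {M : Multiset ℕ} {d : ℕ} (h : genDeg M < d) :
    genProd M ∈ degSpan d := by
  refine Finset.mem_image.2 ⟨⟨genDeg M, oddPartition M⟩, ?_, ?_⟩
  · simp [h, oddPartition_mem]
  · simp only [oddPartition, Multiset.map_map]
    congr 1
    conv_rhs => rw [← Multiset.map_id M]
    refine Multiset.map_congr rfl fun m _ => ?_
    simp only [Function.comp_apply, id]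
    omega

/-- The strict partitions of size less than `d`. -/
def strictLT (d : ℕ) : Finset ((_ : ℕ) × Finset ℕ) := (Finset.range d).sigma strictSets

/-- The independent functions P*_λ with |λ| < d lie in this space, whose dimension is at most the
number of odd partitions of sizes below d; by Euler's theorem that is the number of such λ. -/
theorem degLT_eq_span (d : ℕ) :
    degLT d = Submodule.span ℚ {f | ∃ A : Finset ℕ, 0 ∉ A ∧ ∑ i ∈ A, i < d ∧ f = factP A} := by
  have hle1 : degLT d ≤ Submodule.span ℚ (degSpan d : Set OddRing) := by
    refine Submodule.span_mono ?_
    rintro _ ⟨M, hM, rfl⟩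
    exact genProd_mem_degSpan hM
  have : FiniteDimensional ℚ (Submodule.span ℚ (degSpan d : Set OddRing)) :=
    FiniteDimensional.span_finset ℚ _
  have : FiniteDimensional ℚ (degLT d) := Submodule.finiteDimensional_of_le hle1
  have hfr : Module.finrank ℚ (degLT d) ≤ (strictLT d).card := by
    refine (Submodule.finrank_mono hle1).trans ((finrank_span_finset_le_card _).trans
      (Finset.card_image_le.trans ?_))
    rw [strictLT, Finset.card_sigma, Finset.card_sigma]
    simp only [card_strictSets, le_refl]
  have hmem : ∀ p : strictLT d, 0 ∉ p.1.2 ∧ ∑ i ∈ p.1.2, i = p.1.1 ∧ p.1.1 < d := fun p => by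
    have h := Finset.mem_sigma.1 p.2
    exact ⟨(mem_strictSets.1 h.2).1, (mem_strictSets.1 h.2).2, Finset.mem_range.1 h.1⟩
  have hli : LinearIndependent ℚ fun p : strictLT d => factP p.1.2 := by
    refine linearIndependent_factP.comp (fun p : strictLT d => ⟨p.1.2, (hmem p).1⟩) ?_
    rintro ⟨⟨j, A⟩, hp⟩ ⟨⟨k, B⟩, hq⟩ h
    have hAB : A = B := congrArg Subtype.val h
    subst hAB
    have h1 := (hmem ⟨_, hp⟩).2.1
    have h2 := (hmem ⟨_, hq⟩).2.1
    simp only at h1 h2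
    simp [← h1, ← h2]
  have hrange : Set.range (fun p : strictLT d => factP p.1.2) ⊆
      {f | ∃ A : Finset ℕ, 0 ∉ A ∧ ∑ i ∈ A, i < d ∧ f = factP A} := by
    rintro _ ⟨p, rfl⟩
    exact ⟨p.1.2, (hmem p).1, (hmem p).2.1 ▸ (hmem p).2.2, rfl⟩
  have hsub : Submodule.span ℚ {f | ∃ A : Finset ℕ, 0 ∉ A ∧ ∑ i ∈ A, i < d ∧ f = factP A} ≤
      degLT d := by
    rw [Submodule.span_le]
    rintro _ ⟨A, -, hA, rfl⟩
    refine degLT_mono ?_ (schur_descPochhammer_mem (decr A))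
    rw [decr_sum]
    exact hA
  have heq := Submodule.eq_of_le_of_finrank_le ((Submodule.span_mono hrange).trans hsub) (by
    rw [finrank_span_eq_card hli]
    simpa using hfr)
  exact le_antisymm (heq ▸ Submodule.span_mono hrange) hsub

/-- The factorial Schur `P`-functions form a basis. -/
noncomputable def factBasis : Module.Basis StrictSet ℚ OddRing :=
  Module.Basis.mk linearIndependent_factP (by
    intro f _
    obtain ⟨d, hd⟩ := mem_degLT_of f
    rw [degLT_eq_span] at hd
    refine Submodule.span_mono ?_ hd
    rintro _ ⟨A, hA, -, rfl⟩
    exact ⟨⟨A, hA⟩, rfl⟩)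

theorem factBasis_apply (A : StrictSet) : factBasis A = factP A.1 := by
  simp [factBasis]

theorem evalAll_injective : Function.Injective evalAll := by
  refine LinearMap.injective_of_linearIndependent (v := factBasis) factBasis.span_eq ?_
  have h : evalAll ∘ factBasis = fun (A B : StrictSet) => evalNat B.1 (factP A.1) := by
    funext A B
    simp [factBasis_apply, evalAll]
  rw [h]
  exact linearIndependent_evalNat_factP

/-- This allows identities in `OddRing` to be checked at points that are distinct positive integers,
where the insertion formula applies. -/
theorem ext_evalNat {f g : OddRing} (h : ∀ B : Finset ℕ, 0 ∉ B → evalNat B f = evalNat B g) :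
    f = g :=
  evalAll_injective (funext fun B => h B.1 B.2)

/-! ### The change of basis between P* and P -/

/-- The linear map that sends `P*_λ` to `P_λ`. -/
noncomputable def defactor : OddRing →ₗ[ℚ] OddRing :=
  factBasis.constr ℚ fun A => schurP A.1

theorem defactor_factP {A : Finset ℕ} (hA : 0 ∉ A) : defactor (factP A) = schurP A := by
  have h := factBasis.constr_basis ℚ (fun A : StrictSet => schurP A.1) ⟨A, hA⟩
  rwa [factBasis_apply] at h

theorem defactor_sub_mem {d : ℕ} {f : OddRing} (hf : f ∈ degLT (d + 1)) :
    defactor f - f ∈ degLT d := by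
  rw [degLT_eq_span (d + 1)] at hf
  induction hf using Submodule.span_induction with
  | mem x hx =>
    obtain ⟨A, hA, hs, rfl⟩ := hx
    rw [defactor_factP hA]
    have h := schur_X_pow_sub_mem (decr A)
    rw [decr_sum] at h
    exact degLT_mono (Nat.lt_succ_iff.1 hs) h
  | zero => simp
  | add x y _ _ hx hy =>
    rw [map_add, add_sub_add_comm]; exact add_mem hx hy
  | smul c x _ hx => rw [map_smul, ← smul_sub]; exact Submodule.smul_mem _ _ hx

/-- The map differs from the identity by something that lowers degree: a kernel element descends
through the filtration to 0, and a preimage of f is f corrected by a preimage of the lower-degree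
error. -/
theorem defactor_bijective : Function.Bijective defactor := by
  constructor
  · rw [← LinearMap.ker_eq_bot, LinearMap.ker_eq_bot']
    intro f hf
    obtain ⟨d, hd⟩ := mem_degLT_of f
    induction d with
    | zero => simpa [degLT_zero] using hd
    | succ d ih =>
      have := defactor_sub_mem hd
      rw [hf, zero_sub] at this
      exact ih (neg_mem_iff.1 this)
  · intro f
    obtain ⟨d, hd⟩ := mem_degLT_of f
    induction d generalizing f with
    | zero => exact ⟨0, by simp [degLT_zero] at hd; simp [hd]⟩
    | succ d ih =>
      obtain ⟨g, hg⟩ := ih _ (defactor_sub_mem hd)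
      exact ⟨f - g, by rw [map_sub, hg]; abel⟩

/-- The isomorphism that sends `P_λ` to `P*_λ`. -/
noncomputable def factorize : OddRing ≃ₗ[ℚ] OddRing :=
  (LinearEquiv.ofBijective defactor defactor_bijective).symm

theorem factorize_schurP {A : Finset ℕ} (hA : 0 ∉ A) : factorize (schurP A) = factP A := by
  rw [factorize, LinearEquiv.symm_apply_eq, LinearEquiv.ofBijective_apply, defactor_factP hA]

theorem span_schurP : Submodule.span ℚ {f | ∃ A : Finset ℕ, 0 ∉ A ∧ f = schurP A} = ⊤ := by
  rw [eq_top_iff]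
  intro f _
  obtain ⟨g, rfl⟩ := defactor_bijective.2 f
  induction factBasis.mem_span g using Submodule.span_induction with
  | mem x hx =>
    obtain ⟨A, rfl⟩ := hx
    rw [factBasis_apply, defactor_factP A.2]
    exact Submodule.subset_span ⟨A.1, A.2, rfl⟩
  | zero => simp
  | add x y _ _ hx hy => rw [map_add]; exact add_mem (hx trivial) (hy trivial)
  | smul c x _ hx => rw [map_smul]; exact Submodule.smul_mem _ _ (hx trivial)

/-! ### Pieri and branching rules -/

theorem cons_cons_eq_zero {f : Polynomial ℚ} (hf : f.coeff 0 = 0) (g : OddRing) :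
    cons f (cons f g) = 0 :=
  ext_evalNat fun B _ => by
    rw [map_zero, evalNat, evalOn_cons_cons B _ Nat.cast_injective.injOn hf]

theorem schur_eq_zero_of_adjacent (L₁ L₂ : List (Polynomial ℚ)) {f : Polynomial ℚ}
    (hf : f.coeff 0 = 0) : schur (L₁ ++ f :: f :: L₂) = 0 := by
  induction L₁ with
  | nil => simp [cons_cons_eq_zero hf]
  | cons p L₁ ih => rw [List.cons_append, schur_cons, ih, map_zero]

theorem schur_update_add {L : List ℕ} (hL : L.Nodup) (F : ℕ → Polynomial ℚ) {i : ℕ} (hi : i ∈ L)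
    (p : Polynomial ℚ) (c : ℚ) :
    schur (L.map (Function.update F i (p + c • F i))) =
      schur (L.map (Function.update F i p)) + c • schur (L.map F) := by
  induction L with
  | nil => simp at hi
  | cons a L ih =>
    obtain ⟨ha, hL'⟩ := List.nodup_cons.1 hL
    simp only [List.map_cons, schur_cons]
    rcases eq_or_ne a i with rfl | hai
    · simp only [Function.update_self, map_update_of_notMem _ _ ha, map_add, map_smul,
        LinearMap.add_apply, LinearMap.smul_apply]
    · rw [ih hL' (by simpa [hai.symm] using hi)]
      simp only [Function.update_of_ne hai, map_add, map_smul]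

theorem map_update_id {α : Type*} (F : ℕ → α) (i v : ℕ) (L : List ℕ) :
    L.map (Function.update F i (F v)) = (L.map (Function.update id i v)).map F := by
  rw [List.map_map]
  refine List.map_congr_left fun j _ => ?_
  rcases eq_or_ne j i with rfl | h
  · simp
  · simp [Function.update_of_ne h]

/-- The hypotheses say that v takes the place of i in the order, so no reordering is needed. -/
theorem decr_replace {A : Finset ℕ} {i v : ℕ} (hi : i ∈ A)
    (h₁ : ∀ j ∈ A, i < j → v < j) (h₂ : ∀ j ∈ A, j < i → j < v) :
    decr (insert v (A.erase i)) = (decr A).map (Function.update id i v) := by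
  refine decr_eq_of_pairwise ?_ fun k => ?_
  · rw [List.pairwise_map]
    refine (decr_pairwise A).imp_of_mem fun {a b} ha hb hab => ?_
    rw [mem_decr] at ha hb
    rcases eq_or_ne a i with rfl | hai
    · have : b ≠ a := ne_of_lt hab
      simpa [Function.update_of_ne this] using h₂ b hb hab
    · rcases eq_or_ne b i with rfl | hbi
      · simpa [Function.update_of_ne hai] using h₁ a ha hab
      · simpa [Function.update_of_ne hai, Function.update_of_ne hbi] using hab
  · simp only [List.mem_map, mem_decr, Finset.mem_insert, Finset.mem_erase]
    constructor
    · rintro ⟨a, ha, rfl⟩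
      rcases eq_or_ne a i with rfl | hai
      · simp
      · simp [hai, ha]
    · rintro (rfl | ⟨hk, hkA⟩)
      · exact ⟨i, hi, by simp⟩
      · exact ⟨k, hkA, by simp [Function.update_of_ne hk]⟩

theorem decr_split {A : Finset ℕ} {i : ℕ} (h₀ : i ∈ A) (h₁ : i + 1 ∈ A) :
    ∃ L₁ L₂ : List ℕ, i ∉ L₁ ∧ i + 1 ∉ L₁ ∧ i ∉ L₂ ∧ i + 1 ∉ L₂ ∧
      decr A = L₁ ++ (i + 1) :: i :: L₂ := by
  refine ⟨decr (A.filter (i + 1 < ·)), decr (A.filter (· < i)), by simp [mem_decr],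
    by simp [mem_decr], by simp [mem_decr], by simp [mem_decr], decr_eq_of_pairwise ?_ fun k => ?_⟩
  · simp only [List.pairwise_append, List.pairwise_cons, decr_pairwise, List.mem_cons, mem_decr,
      Finset.mem_filter]
    grind
  · simp only [List.mem_append, List.mem_cons, mem_decr, Finset.mem_filter]
    grind

theorem decr_append_one {A : Finset ℕ} (h₀ : 0 ∉ A) (h₁ : 1 ∉ A) :
    decr (insert 1 A) = decr A ++ [1] := by
  refine decr_eq_of_pairwise ?_ fun k => ?_
  · simp only [List.pairwise_append, decr_pairwise, List.pairwise_singleton, List.mem_singleton,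
      mem_decr]
    grind
  · simp only [List.mem_append, List.mem_singleton, mem_decr, Finset.mem_insert]
    grind

/-- The lengths (`0` for an empty row) that can be increased by one. -/
def addable (A : Finset ℕ) : Finset ℕ := (insert 0 A).filter (· + 1 ∉ A)

/-- The lengths that can be decreased by one. -/
def removable (B : Finset ℕ) : Finset ℕ := B.filter (· - 1 ∉ B)

/-- Replacement of the length `i` by `i + 1`. -/
def addBox (A : Finset ℕ) (i : ℕ) : Finset ℕ := insert (i + 1) (A.erase i)

/-- Replacement of the length `j` by `j - 1`. -/
def removeBox (B : Finset ℕ) (j : ℕ) : Finset ℕ := (insert (j - 1) (B.erase j)).erase 0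

theorem mem_addable {A : Finset ℕ} {i : ℕ} : i ∈ addable A ↔ (i = 0 ∨ i ∈ A) ∧ i + 1 ∉ A := by
  simp [addable]

theorem mem_removable {B : Finset ℕ} {j : ℕ} : j ∈ removable B ↔ j ∈ B ∧ j - 1 ∉ B := by
  simp [removable]

/-- One Pieri rule for both families: c = 0 for powers and c(m) = m for falling powers, because
x·x^{↓m} = x^{↓(m+1)} + m x^{↓m}. -/
theorem gen_zero_mul_schur_decr {F : ℕ → Polynomial ℚ} {c : ℕ → ℚ} (hF₁ : F 1 = Polynomial.X)
    (hF₀ : ∀ m, m ≠ 0 → (F m).coeff 0 = 0)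
    (hF : ∀ m, F m * Polynomial.X = F (m + 1) + c m • F m) {A : Finset ℕ} (hA : 0 ∉ A) :
    gen 0 * schur ((decr A).map F) =
      ∑ i ∈ addable A, schur ((decr (addBox A i)).map F) +
        (∑ i ∈ A, c i) • schur ((decr A).map F) := by
  have h1 : ∀ i ∈ A, schur ((decr A).map (Function.update F i (F i * Polynomial.X))) =
      (if i + 1 ∉ A then schur ((decr (addBox A i)).map F) else 0) +
        c i • schur ((decr A).map F) := by
    intro i hi
    rw [hF, schur_update_add (decr_nodup A) F (mem_decr.2 hi)]
    congr 1
    -- If i + 1 is already a part, raising i gives two equal adjacent entries and the term is zero.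
    by_cases h : i + 1 ∈ A
    · rw [if_neg (by simpa using h)]
      obtain ⟨L₁, L₂, h2, h3, h4, h5, h6⟩ := decr_split hi h
      rw [h6, List.map_append, List.map_cons, List.map_cons, Function.update_self,
        Function.update_of_ne (by simp)]
      exact schur_eq_zero_of_adjacent _ _ (hF₀ _ (by simp))
    · rw [if_pos h, addBox, decr_replace hi, map_update_id]
      · exact fun j hj hij => lt_of_le_of_ne hij fun h' => h (by rwa [← h'] at hj)
      · exact fun j _ hji => Nat.lt_succ_of_lt hji
  -- The appended entry X = F 1 is a new row of length 1; it cancels if such a row exists.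
  have h2 : schur ((decr A).map F ++ [Polynomial.X]) =
      if 1 ∉ A then schur ((decr (addBox A 0)).map F) else 0 := by
    by_cases h : 1 ∈ A
    · rw [if_neg (by simpa using h)]
      have h3 : decr A = decr (A.erase 1) ++ [1] := by
        conv_lhs => rw [← Finset.insert_erase h]
        exact decr_append_one (by simp [hA]) (by simp)
      rw [h3, List.map_append, List.append_assoc, List.map_singleton, hF₁]
      exact schur_eq_zero_of_adjacent _ [] (by simp)
    · rw [if_pos h, addBox, Finset.erase_eq_of_notMem hA, zero_add, decr_append_one hA h,
        List.map_append, List.map_singleton, hF₁]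
  rw [gen_zero_mul_schur (decr_nodup A), h2, ← List.sum_toFinset _ (decr_nodup A), decr_toFinset,
    Finset.sum_congr rfl h1, Finset.sum_add_distrib, Finset.sum_smul, addable, Finset.sum_filter,
    Finset.sum_insert hA]
  abel

theorem gen_zero_mul_schurP {A : Finset ℕ} (hA : 0 ∉ A) :
    gen 0 * schurP A = ∑ i ∈ addable A, schurP (addBox A i) := by
  have h := gen_zero_mul_schur_decr (F := fun m => Polynomial.X ^ m) (c := fun _ => 0) (by simp)
    (fun m hm => by simp [Polynomial.coeff_X_pow, hm.symm]) (fun m => by simp [pow_succ]) hA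
  simpa [schurP] using h

theorem gen_zero_mul_factP {A : Finset ℕ} (hA : 0 ∉ A) :
    gen 0 * factP A =
      ∑ i ∈ addable A, factP (addBox A i) + (∑ i ∈ A, (i : ℚ)) • factP A :=
  gen_zero_mul_schur_decr (F := descPochhammer ℚ) (c := fun i => i) (descPochhammer_one ℚ)
    (fun _ hm => descPochhammer_coeff_zero hm)
    (fun m => by
      rw [descPochhammer_succ_right, Polynomial.smul_eq_C_mul, map_natCast]; ring) hA

/-- Lowering a part to an existing one gives zero. Lowering a part 1 leaves a trailing entry 1,
worth 1/2 by `schur_append_one`, which turns the coefficient 2 into 1. -/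
theorem dOne_schurP {B : Finset ℕ} (hB : 0 ∉ B) :
    dOne (schurP B) =
      ∑ j ∈ removable B, (if j = 1 then 1 else 2 : ℚ) • schurP (removeBox B j) := by
  rw [schurP, dOne_schur (decr_nodup B) (fun i => i)
    (fun i hi => by rintro rfl; exact hB (mem_decr.1 hi)),
    ← List.sum_toFinset _ (decr_nodup B), decr_toFinset, removable, Finset.sum_filter]
  refine Finset.sum_congr rfl fun j hj => ?_
  have hj0 : j ≠ 0 := by rintro rfl; exact hB hj
  have e2 : ∀ f : OddRing, 2 * f = (2 : ℚ) • f := fun f => by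
    rw [MvPolynomial.smul_eq_C_mul, map_ofNat]
  have e := map_update_id (fun m => (Polynomial.X ^ m : Polynomial ℚ)) j (j - 1) (decr B)
  rw [e2, e]
  rcases eq_or_ne j 1 with rfl | hj1
  · rw [if_pos (by simpa using hB), if_pos rfl, removeBox]
    have h3 : decr B = decr (B.erase 1) ++ [1] := by
      conv_lhs => rw [← Finset.insert_erase hj]
      exact decr_append_one (by simp [hB]) (by simp)
    have h4 : (insert (1 - 1) (B.erase 1)).erase 0 = B.erase 1 := by
      rw [Finset.erase_insert]; simp [hB]
    have h5 : (decr (B.erase 1)).map (Function.update id 1 (1 - 1)) = decr (B.erase 1) := by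
      rw [map_update_of_notMem _ _ (by simp [mem_decr]), List.map_id]
    rw [h3, h4, List.map_append, h5, List.map_append]
    simp only [List.map_singleton, Function.update_self, Nat.sub_self, pow_zero]
    rw [schur_append_one, ← MvPolynomial.smul_eq_C_mul, smul_smul, schurP]
    norm_num
  · rw [if_neg hj1]
    by_cases h : j - 1 ∈ B
    · rw [if_neg (by simpa using h)]
      have hjj : j - 1 + 1 = j := by omega
      obtain ⟨L₁, L₂, h2, h3, h4, h5, h6⟩ := decr_split h (by rwa [hjj])
      rw [h6, hjj, List.map_append, List.map_cons, List.map_cons, Function.update_self,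
        Function.update_of_ne (by omega), List.map_append, List.map_cons, List.map_cons, id,
        schur_eq_zero_of_adjacent, smul_zero]
      have : ¬ 0 = j - 1 := by omega
      simp [Polynomial.coeff_X_pow, this]
    · rw [if_pos h, removeBox, Finset.erase_eq_of_notMem (a := 0), schurP, decr_replace hj]
      · exact fun k hk hjk => by omega
      · intro k hk hkj
        have : k ≠ j - 1 := by rintro rfl; exact h hk
        omega
      · simp only [Finset.mem_insert, Finset.mem_erase, not_or, not_and]
        exact ⟨by omega, fun _ => hB⟩

/-! ### Boxes and sizes -/

theorem addBox_mem {n : ℕ} {A : Finset ℕ} (hA : A ∈ strictSets n) {i : ℕ} (hi : i ∈ addable A) :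
    addBox A i ∈ strictSets (n + 1) := by
  rw [mem_strictSets] at hA ⊢
  obtain ⟨hi, hi1⟩ := mem_addable.1 hi
  refine ⟨by simp [addBox, hA.1], ?_⟩
  rw [addBox, Finset.sum_insert (fun h => hi1 (Finset.mem_of_mem_erase h))]
  rcases hi with rfl | hi
  · rw [Finset.erase_eq_of_notMem hA.1, hA.2]; ring
  · have := Finset.add_sum_erase A (fun i => i) hi
    omega

theorem removeBox_mem {n : ℕ} {B : Finset ℕ} (hB : B ∈ strictSets (n + 1)) {j : ℕ}
    (hj : j ∈ removable B) : removeBox B j ∈ strictSets n := by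
  rw [mem_strictSets] at hB ⊢
  obtain ⟨hj, hj1⟩ := mem_removable.1 hj
  have hj0 : j ≠ 0 := by rintro rfl; exact hB.1 hj
  refine ⟨by simp [removeBox], ?_⟩
  have h0 : ∑ i ∈ removeBox B j, i = ∑ i ∈ insert (j - 1) (B.erase j), i := by
    rw [removeBox]
    exact Finset.sum_erase _ rfl
  rw [h0, Finset.sum_insert (fun h => hj1 (Finset.mem_of_mem_erase h))]
  have := Finset.add_sum_erase B (fun i => i) hj
  omega

theorem succ_mem_removable (A : Finset ℕ) (i : ℕ) :
    i + 1 ∈ removable (addBox A i) := by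
  simp [mem_removable, addBox]

theorem removeBox_addBox {A : Finset ℕ} (hA : 0 ∉ A) {i : ℕ} (hi : i ∈ addable A) :
    removeBox (addBox A i) (i + 1) = A := by
  obtain ⟨hi, hi1⟩ := mem_addable.1 hi
  ext k
  simp only [removeBox, addBox, Finset.mem_erase, Finset.mem_insert, Nat.add_sub_cancel]
  grind

theorem pred_mem_addable {B : Finset ℕ} (hB : 0 ∉ B) {j : ℕ} (hj : j ∈ removable B) :
    j - 1 ∈ addable (removeBox B j) := by
  obtain ⟨hj, hj1⟩ := mem_removable.1 hj
  have hj0 : j ≠ 0 := by rintro rfl; exact hB hj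
  simp only [mem_addable, removeBox, Finset.mem_erase, Finset.mem_insert]
  grind

theorem addBox_removeBox {B : Finset ℕ} (hB : 0 ∉ B) {j : ℕ} (hj : j ∈ removable B) :
    addBox (removeBox B j) (j - 1) = B := by
  obtain ⟨hj, hj1⟩ := mem_removable.1 hj
  have hj0 : j ≠ 0 := by rintro rfl; exact hB hj
  have : j - 1 + 1 = j := by omega
  ext k
  simp only [removeBox, addBox, Finset.mem_erase, Finset.mem_insert, this]
  grind

/-- Both sides sum over the edges between levels n and n + 1 of the graph of strict partitions. -/
theorem sum_addBox_comm {M : Type*} [AddCommMonoid M] (n : ℕ) (G : Finset ℕ → Finset ℕ → M) :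
    ∑ A ∈ strictSets n, ∑ i ∈ addable A, G A (addBox A i) =
      ∑ B ∈ strictSets (n + 1), ∑ j ∈ removable B, G (removeBox B j) B := by
  rw [Finset.sum_sigma', Finset.sum_sigma']
  refine Finset.sum_bij' (fun p _ => ⟨addBox p.1 p.2, p.2 + 1⟩)
    (fun p _ => ⟨removeBox p.1 p.2, p.2 - 1⟩) ?_ ?_ ?_ ?_ ?_
  · rintro ⟨A, i⟩ h
    obtain ⟨h1, h2⟩ := Finset.mem_sigma.1 h
    exact Finset.mem_sigma.2 ⟨addBox_mem h1 h2, succ_mem_removable A i⟩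
  · rintro ⟨B, j⟩ h
    obtain ⟨h1, h2⟩ := Finset.mem_sigma.1 h
    exact Finset.mem_sigma.2 ⟨removeBox_mem h1 h2, pred_mem_addable (mem_strictSets.1 h1).1 h2⟩
  · rintro ⟨A, i⟩ h
    obtain ⟨h1, h2⟩ := Finset.mem_sigma.1 h
    simp only [removeBox_addBox (mem_strictSets.1 h1).1 h2, Nat.add_sub_cancel]
  · rintro ⟨B, j⟩ h
    obtain ⟨h1, h2⟩ := Finset.mem_sigma.1 h
    have hj0 : j ≠ 0 := by
      rintro rfl; exact (mem_strictSets.1 h1).1 (mem_removable.1 h2).1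
    have : j - 1 + 1 = j := by omega
    simp only [addBox_removeBox (mem_strictSets.1 h1).1 h2, this]
  · rintro ⟨A, i⟩ h
    obtain ⟨h1, h2⟩ := Finset.mem_sigma.1 h
    simp only [removeBox_addBox (mem_strictSets.1 h1).1 h2]

theorem card_le_of_mem_strictSets {n : ℕ} {A : Finset ℕ} (hA : A ∈ strictSets n) :
    A.card ≤ n := by
  obtain ⟨h0, rfl⟩ := mem_strictSets.1 hA
  rw [Finset.card_eq_sum_ones]
  exact Finset.sum_le_sum fun i hi => Nat.one_le_iff_ne_zero.2 (by rintro rfl; exact h0 hi)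

theorem card_removeBox {B : Finset ℕ} (hB : 0 ∉ B) {j : ℕ} (hj : j ∈ removable B) :
    (removeBox B j).card + (if j = 1 then 1 else 0) = B.card := by
  obtain ⟨hj, hj1⟩ := mem_removable.1 hj
  have hj0 : j ≠ 0 := by rintro rfl; exact hB hj
  have hc := Finset.card_erase_add_one hj
  rcases eq_or_ne j 1 with rfl | h1
  · rw [if_pos rfl, ← hc, removeBox, Finset.erase_insert (by simp [hB])]
  · rw [if_neg h1, add_zero, removeBox, Finset.erase_eq_of_notMem, Finset.card_insert_of_notMem, hc]
    · exact fun h => hj1 (Finset.mem_of_mem_erase h)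
    · simp only [Finset.mem_insert, Finset.mem_erase, not_or, not_and]
      exact ⟨by omega, fun _ => hB⟩

/-- The number of ways to remove `n` boxes one after another. -/
def pathCount : ℕ → Finset ℕ → ℕ
  | 0, _ => 1
  | n + 1, B => ∑ j ∈ removable B, pathCount n (removeBox B j)

/-! ### The coefficient of `x_1 ⋯ x_j` -/

/-- The coefficient of `x_1 ⋯ x_j`, that is, the constant term of `(∂/∂p_1)^j`. -/
noncomputable def mixedCoeff (j : ℕ) : OddRing →ₗ[ℚ] ℚ :=
  (evalNat ∅).toLinearMap ∘ₗ dOne.toLinearMap ^ j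

theorem mixedCoeff_zero (f : OddRing) : mixedCoeff 0 f = evalNat ∅ f := rfl

theorem mixedCoeff_succ (j : ℕ) (f : OddRing) : mixedCoeff (j + 1) f = mixedCoeff j (dOne f) := by
  simp [mixedCoeff, pow_succ]

theorem dOne_gen_mul (m : ℕ) (f : OddRing) :
    dOne (gen m * f) = (if m = 0 then f else 0) + gen m * dOne f := by
  rw [Derivation.leibniz, dOne_gen, smul_eq_mul, smul_eq_mul]
  split_ifs <;> ring

theorem mixedCoeff_zero_gen_mul (m : ℕ) (f : OddRing) : mixedCoeff 0 (gen m * f) = 0 := by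
  rw [mixedCoeff_zero, map_mul, evalNat, evalOn_gen]; simp

/-- The commutator of ∂/∂p_1 and p_1 is 1, and p_1 f has no constant term. -/
theorem mixedCoeff_succ_gen_zero_mul (j : ℕ) (f : OddRing) :
    mixedCoeff (j + 1) (gen 0 * f) = (j + 1) * mixedCoeff j f := by
  induction j generalizing f with
  | zero =>
    rw [mixedCoeff_succ, dOne_gen_mul, if_pos rfl, map_add, mixedCoeff_zero_gen_mul]; simp
  | succ j ih =>
    rw [mixedCoeff_succ, dOne_gen_mul, if_pos rfl, map_add, ih, mixedCoeff_succ]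
    push_cast; ring

theorem mixedCoeff_gen_mul_of_ne {m : ℕ} (hm : m ≠ 0) (j : ℕ) (f : OddRing) :
    mixedCoeff j (gen m * f) = 0 := by
  induction j generalizing f with
  | zero => exact mixedCoeff_zero_gen_mul m f
  | succ j ih => rw [mixedCoeff_succ, dOne_gen_mul, if_neg hm, zero_add, ih]

theorem mixedCoeff_genProd (j : ℕ) (M : Multiset ℕ) :
    mixedCoeff j (genProd M) = if M = Multiset.replicate j 0 then (j.factorial : ℚ) else 0 := by
  induction M using Multiset.induction_on generalizing j with
  | empty =>
    cases j with
    | zero => simp [mixedCoeff_zero, genProd]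
    | succ j =>
      have : (0 : Multiset ℕ) ≠ Multiset.replicate (j + 1) 0 := fun h => by
        simpa using congrArg Multiset.card h
      rw [if_neg this, mixedCoeff_succ]
      simp [genProd]
  | cons m M ih =>
    rw [genProd_cons]
    rcases eq_or_ne m 0 with rfl | hm
    · cases j with
      | zero => simp [mixedCoeff_zero_gen_mul]
      | succ j =>
        rw [mixedCoeff_succ_gen_zero_mul, ih, Multiset.replicate_succ]
        simp only [Multiset.cons_inj_right, Nat.factorial_succ]
        push_cast
        split_ifs <;> ring
    · rw [mixedCoeff_gen_mul_of_ne hm, if_neg]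
      intro h
      exact hm (Multiset.eq_of_mem_replicate (h ▸ Multiset.mem_cons_self m M))

/-- The number `2^(n - ℓ(λ)) g^λ`. -/
def pathWeight (n : ℕ) (A : Finset ℕ) : ℚ := 2 ^ (n - A.card) * (pathCount n A : ℚ)

theorem strictSets_zero {A : Finset ℕ} (hA : A ∈ strictSets 0) : A = ∅ := by
  obtain ⟨h0, hs⟩ := mem_strictSets.1 hA
  refine Finset.eq_empty_of_forall_notMem fun i hi => h0 ?_
  rwa [← Finset.sum_eq_zero_iff.1 hs i hi]

theorem evalNat_empty_schurP {n : ℕ} {A : Finset ℕ} (hA : A ∈ strictSets (n + 1)) :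
    evalNat ∅ (schurP A) = 0 := by
  obtain ⟨h0, hs⟩ := mem_strictSets.1 hA
  unfold schurP
  have hs' := decr_sum A
  have hmem : ∀ i ∈ decr A, i ≠ 0 := by
    rintro i hi rfl
    exact h0 (mem_decr.1 hi)
  cases h : decr A with
  | nil => rw [h, List.sum_nil] at hs'; omega
  | cons m L =>
    have hm : 0 ≠ m := (hmem m (by simp [h])).symm
    rw [List.map_cons, schur_cons, evalNat, evalOn_cons ∅ _ Nat.cast_injective.injOn
      (by simp [Polynomial.coeff_X_pow, hm]), Finset.sum_empty]

/-- Each ∂/∂p_1 removes a box, with a factor 2 unless a row disappears. A full removal of n boxes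
loses ℓ rows, hence the weight 2^{n-ℓ}. -/
theorem mixedCoeff_schurP {n : ℕ} {A : Finset ℕ} (hA : A ∈ strictSets n) (j : ℕ) :
    mixedCoeff j (schurP A) = if j = n then pathWeight n A else 0 := by
  induction n generalizing A j with
  | zero =>
    have hP : schurP ∅ = 1 := by simp [schurP, decr]
    rw [strictSets_zero hA, hP]
    cases j with
    | zero => simp [mixedCoeff_zero, pathWeight, pathCount]
    | succ j => simp [mixedCoeff_succ]
  | succ n ih =>
    cases j with
    | zero => rw [mixedCoeff_zero, evalNat_empty_schurP hA, if_neg (by omega)]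
    | succ j =>
      have h0 := (mem_strictSets.1 hA).1
      rw [mixedCoeff_succ, dOne_schurP h0, map_sum]
      have h1 : ∀ r ∈ removable A, mixedCoeff j ((if r = 1 then 1 else 2 : ℚ) •
          schurP (removeBox A r)) = if j = n then
            2 ^ (n + 1 - A.card) * (pathCount n (removeBox A r) : ℚ) else 0 := by
        intro r hr
        have hm := removeBox_mem hA hr
        have hc := card_removeBox h0 hr
        have hle := card_le_of_mem_strictSets hm
        rw [map_smul, ih hm, smul_eq_mul, mul_ite, mul_zero, pathWeight, ← mul_assoc]
        congr 2
        rcases eq_or_ne r 1 with rfl | h1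
        · rw [if_pos rfl] at hc ⊢
          rw [one_mul, ← hc, Nat.add_sub_add_right]
        · rw [if_neg h1] at hc ⊢
          rw [← hc, add_zero, Nat.succ_sub hle, pow_succ, mul_comm]
      rw [Finset.sum_congr rfl h1]
      by_cases hj : j = n
      · simp only [hj, if_true, ← Finset.mul_sum, pathWeight, pathCount]
        push_cast; rfl
      · rw [if_neg (by omega)]
        exact Finset.sum_eq_zero fun _ _ => if_neg hj

/-- The shifted Plancherel measures are coherent. -/
theorem sum_pathWeight_addBox {n : ℕ} {A : Finset ℕ} (hA : A ∈ strictSets n) :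
    ∑ i ∈ addable A, pathWeight (n + 1) (addBox A i) = (n + 1) * pathWeight n A := by
  -- The coefficient of p_1 P_A is computed twice: by the commutator and by the Pieri rule.
  have h := mixedCoeff_succ_gen_zero_mul n (schurP A)
  rw [gen_zero_mul_schurP (mem_strictSets.1 hA).1, map_sum, mixedCoeff_schurP hA, if_pos rfl] at h
  rw [← h]
  refine Finset.sum_congr rfl fun i hi => ?_
  rw [mixedCoeff_schurP (addBox_mem hA hi), if_pos rfl]

/-! ### Averages -/

theorem evalNat_gen_zero {n : ℕ} {B : Finset ℕ} (hB : B ∈ strictSets n) :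
    evalNat B (gen 0) = n := by
  rw [evalNat, evalOn_gen, ← (mem_strictSets.1 hB).2]
  simp

/-- The Pieri rule for P*, evaluated at B, where p_1 takes the value n. -/
theorem sum_evalNat_addBox {n k : ℕ} {A B : Finset ℕ} (hA : A ∈ strictSets k)
    (hB : B ∈ strictSets n) :
    ∑ i ∈ addable A, evalNat B (factP (addBox A i)) = ((n : ℚ) - k) * evalNat B (factP A) := by
  have h := congrArg (evalNat B) (gen_zero_mul_factP (mem_strictSets.1 hA).1)
  rw [map_mul, evalNat_gen_zero hB, map_add, map_sum, map_smul, smul_eq_mul, ← Nat.cast_sum,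
    (mem_strictSets.1 hA).2] at h
  linarith

/-- Expanding `pathCount` along the last box and regrouping by the smaller partition produces a
factor n - j at each step. -/
theorem sum_pathCount_mul_evalNat {n : ℕ} {B : Finset ℕ} (hB : B ∈ strictSets n) (j : ℕ) :
    ∑ A ∈ strictSets j, (pathCount j A : ℚ) * evalNat B (factP A) = n.descFactorial j := by
  induction j with
  | zero =>
    have h : strictSets 0 = {∅} := by
      ext A
      refine ⟨fun h => by simpa using strictSets_zero h, fun h => ?_⟩
      rw [Finset.mem_singleton.1 h, mem_strictSets]; simp
    simp [h, pathCount, factP, decr]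
  | succ j ih =>
    have h1 : ∑ A ∈ strictSets (j + 1), (pathCount (j + 1) A : ℚ) * evalNat B (factP A) =
        ∑ A ∈ strictSets (j + 1), ∑ r ∈ removable A,
          (pathCount j (removeBox A r) : ℚ) * evalNat B (factP A) := by
      simp only [pathCount, Nat.cast_sum, Finset.sum_mul]
    rw [h1, ← sum_addBox_comm j fun A C => (pathCount j A : ℚ) * evalNat B (factP C)]
    have h2 : ∀ A ∈ strictSets j, ∑ i ∈ addable A,
        (pathCount j A : ℚ) * evalNat B (factP (addBox A i)) =
        ((n : ℚ) - j) * ((pathCount j A : ℚ) * evalNat B (factP A)) := by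
      intro A hA
      rw [← Finset.mul_sum, sum_evalNat_addBox hA hB]; ring
    rw [Finset.sum_congr rfl h2, ← Finset.mul_sum, ih, Nat.descFactorial_succ]
    rcases le_or_gt j n with hj | hj
    · rw [Nat.cast_mul, Nat.cast_sub hj]
    · rw [Nat.descFactorial_eq_zero_iff_lt.2 hj]; simp

/-- The hook length formula: `g^λ P*_λ(λ) = n!`. -/
theorem pathCount_mul_evalNat_self {n : ℕ} {B : Finset ℕ} (hB : B ∈ strictSets n) :
    (pathCount n B : ℚ) * evalNat B (factP B) = n.factorial := by
  rw [← Nat.descFactorial_self, ← sum_pathCount_mul_evalNat hB n, Finset.sum_eq_single_of_mem B hB]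
  intro A hA hne
  rw [mem_strictSets] at hA hB
  rw [evalNat_factP_of_le hA.1 hB.1 (by omega) hne, mul_zero]

/-- The average of a supersymmetric function under the shifted Plancherel measure. -/
noncomputable def plancherelAverage (n : ℕ) : OddRing →ₗ[ℚ] ℚ :=
  ∑ B ∈ strictSets n, (pathWeight n B * pathCount n B / n.factorial) • (evalNat B).toLinearMap

theorem plancherelAverage_apply (n : ℕ) (f : OddRing) :
    plancherelAverage n f =
      ∑ B ∈ strictSets n, pathWeight n B * pathCount n B / n.factorial * evalNat B f := by
  simp [plancherelAverage]

theorem plancherelAverage_factP_of_lt {n k : ℕ} (h : n < k) {A : Finset ℕ}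
    (hA : A ∈ strictSets k) : plancherelAverage n (factP A) = 0 := by
  rw [plancherelAverage_apply]
  refine Finset.sum_eq_zero fun B hB => ?_
  rw [mem_strictSets] at hA hB
  rw [evalNat_factP_of_le hA.1 hB.1 (by omega) (by rintro rfl; omega), mul_zero]

/-- Induction on n - k. Averaging the Pieri rule expresses (n - k) E_n[P*_A] through the larger
partitions A + box, whose weights add up by coherence. For n = k only B = A contributes, and the
hook length formula applies. -/
theorem plancherelAverage_factP {n k : ℕ} {A : Finset ℕ} (hA : A ∈ strictSets k) :
    plancherelAverage n (factP A) = n.choose k * pathWeight k A := by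
  rcases lt_or_ge n k with h | h
  · rw [plancherelAverage_factP_of_lt h hA, Nat.choose_eq_zero_of_lt h]; simp
  obtain ⟨m, rfl⟩ := Nat.exists_eq_add_of_le h
  clear h
  induction m generalizing k A with
  | zero =>
    rw [add_zero, plancherelAverage_apply, Finset.sum_eq_single_of_mem A hA]
    · have h := pathCount_mul_evalNat_self hA
      have h0 : ((k.factorial : ℕ) : ℚ) ≠ 0 := by exact_mod_cast k.factorial_ne_zero
      rw [Nat.choose_self, Nat.cast_one, one_mul, div_mul_eq_mul_div, mul_assoc, h,
        mul_div_cancel_right₀ _ h0]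
    · intro B hB hne
      rw [mem_strictSets] at hA hB
      rw [evalNat_factP_of_le hA.1 hB.1 (by omega) hne.symm, mul_zero]
  | succ m ih =>
    have h1 : ((m : ℚ) + 1) * plancherelAverage (k + (m + 1)) (factP A) =
        ∑ i ∈ addable A, plancherelAverage (k + (m + 1)) (factP (addBox A i)) := by
      simp only [plancherelAverage_apply]
      rw [Finset.sum_comm, Finset.mul_sum]
      refine Finset.sum_congr rfl fun B hB => ?_
      rw [← Finset.mul_sum, sum_evalNat_addBox hA hB]
      push_cast; ring
    have h2 : ∀ i ∈ addable A, plancherelAverage (k + (m + 1)) (factP (addBox A i)) =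
        (k + (m + 1)).choose (k + 1) * pathWeight (k + 1) (addBox A i) := fun i hi => by
      have := ih (addBox_mem hA hi)
      rwa [show k + 1 + m = k + (m + 1) by ring] at this
    rw [Finset.sum_congr rfl h2, ← Finset.mul_sum, sum_pathWeight_addBox hA] at h1
    have h3 : ((k + (m + 1)).choose (k + 1) : ℚ) * (k + 1) =
        (k + (m + 1)).choose k * (m + 1) := by
      have := Nat.choose_succ_right_eq (k + (m + 1)) k
      rw [Nat.add_sub_cancel_left] at this
      exact_mod_cast this
    have h4 : (m : ℚ) + 1 ≠ 0 := by positivity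
    apply mul_left_cancel₀ h4
    linear_combination h1 + pathWeight k A * h3

/-- Both sides are linear in f and agree on every P_λ. -/
theorem plancherelAverage_factorize (n : ℕ) (f : OddRing) :
    plancherelAverage n (factorize f) =
      ∑ j ∈ Finset.range (n + 1), (n.choose j : ℚ) * mixedCoeff j f := by
  have hf : f ∈ Submodule.span ℚ {f | ∃ A : Finset ℕ, 0 ∉ A ∧ f = schurP A} := by
    rw [span_schurP]; trivial
  induction hf using Submodule.span_induction with
  | mem x hx =>
    obtain ⟨A, hA, rfl⟩ := hx
    have hA' : A ∈ strictSets (∑ i ∈ A, i) := mem_strictSets.2 ⟨hA, rfl⟩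
    generalize ∑ i ∈ A, i = k at hA'
    simp only [factorize_schurP hA, plancherelAverage_factP hA', mixedCoeff_schurP hA', mul_ite,
      mul_zero, Finset.sum_ite_eq', Finset.mem_range]
    split_ifs with h
    · rfl
    · rw [Nat.choose_eq_zero_of_lt (by omega)]; simp
  | zero => simp
  | add x y _ _ hx hy => simp only [map_add, hx, hy, mul_add, Finset.sum_add_distrib]
  | smul c x _ hx =>
    simp only [map_smul, hx, smul_eq_mul, Finset.mul_sum]
    exact Finset.sum_congr rfl fun _ _ => by ring

theorem plancherelAverage_factorize_genProd (n : ℕ) (M : Multiset ℕ) :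
    plancherelAverage n (factorize (genProd M)) =
      if M = Multiset.replicate M.card 0 then (n.descFactorial M.card : ℚ) else 0 := by
  have h1 : ∀ j, M = Multiset.replicate j 0 ↔ j = M.card ∧ M = Multiset.replicate M.card 0 := by
    intro j
    constructor
    · intro h
      have hc : j = M.card := by rw [h, Multiset.card_replicate]
      exact ⟨hc, by rwa [← hc]⟩
    · rintro ⟨rfl, h⟩
      exact h
  rw [plancherelAverage_factorize]
  simp only [mixedCoeff_genProd]
  by_cases h : M = Multiset.replicate M.card 0
  · rw [if_pos h]
    have h2 : ∀ j, (if M = Multiset.replicate j 0 then (j.factorial : ℚ) else 0) =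
        if j = M.card then (j.factorial : ℚ) else 0 := fun j =>
      if_congr ((h1 j).trans (and_iff_left h)) rfl rfl
    simp only [h2, mul_ite, mul_zero, Finset.sum_ite_eq', Finset.mem_range]
    rw [Nat.descFactorial_eq_factorial_mul_choose]
    split_ifs with h3
    · push_cast; ring
    · rw [Nat.choose_eq_zero_of_lt (by omega)]; simp
  · rw [if_neg h]
    refine Finset.sum_eq_zero fun j _ => ?_
    rw [if_neg (fun h' => h ((h1 j).1 h').2), mul_zero]

/-! ### Families of polynomials -/

/-- The family of polynomials of a supersymmetric function. -/
noncomputable def toFamily : OddRing →ₐ[ℚ] PolyFamily :=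
  MvPolynomial.aeval fun m => powerSum (2 * m + 1)

theorem toFamily_range : toFamily.range = Gamma := by
  rw [toFamily, ← Algebra.adjoin_range_eq_range_aeval, Gamma]
  congr 1
  ext F
  simp [eq_comm]

theorem map_toFamily {K : Type*} [Field K] [Algebra ℚ K] {N : ℕ}
    (ψ : MvPolynomial (Fin N) ℚ →ₐ[ℚ] K) (f : OddRing) :
    ψ (toFamily f N) = evalOn Finset.univ (fun i => ψ (MvPolynomial.X i)) f := by
  have h : (ψ.comp (Pi.evalAlgHom ℚ (fun N => MvPolynomial (Fin N) ℚ) N)).comp toFamily =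
      evalOn Finset.univ (fun i => ψ (MvPolynomial.X i)) := by
    refine MvPolynomial.algHom_ext fun m => ?_
    simp [toFamily, powerSum, evalOn_gen, MvPolynomial.psum]
  exact DFunLike.congr_fun h f

theorem row_eq {n : ℕ} {lam : n.Partition} (h : lam ∈ Nat.Partition.distincts n) :
    row lam = decr lam.parts.toFinset := by
  rw [row, decr, ← Finset.sort_val, Multiset.toFinset_val, (mem_distincts.1 h).dedup]

theorem row_length {n : ℕ} (lam : n.Partition) : (row lam).length = len lam :=
  Multiset.length_sort _

theorem sum_part {n : ℕ} {lam : n.Partition} (h : lam ∈ Nat.Partition.distincts n) (f : ℕ → ℚ) :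
    ∑ i : Fin (len lam), f (part lam i) = ∑ a ∈ lam.parts.toFinset, f a := by
  rw [Fin.sum_univ_eq_sum_range (fun i => f (part lam i)), ← row_length, ← Fin.sum_univ_eq_sum_range
    (fun i => f (part lam i)), ← decr_toFinset lam.parts.toFinset,
    List.sum_toFinset _ (decr_nodup _), ← row_eq h, ← Fin.sum_univ_fun_getElem]
  refine Finset.sum_congr rfl fun i _ => ?_
  rw [part, List.getD_eq_getElem _ _ i.2]

theorem value_toFamily {n : ℕ} {lam : n.Partition} (h : lam ∈ Nat.Partition.distincts n)
    (f : OddRing) : value (toFamily f) lam = evalNat lam.parts.toFinset f := by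
  have h1 := map_toFamily (MvPolynomial.aeval fun i : Fin (len lam) => (part lam i : ℚ)) f
  have h2 : evalOn Finset.univ (fun i : Fin (len lam) =>
      MvPolynomial.aeval (fun i : Fin (len lam) => (part lam i : ℚ))
        (MvPolynomial.X i : MvPolynomial (Fin (len lam)) ℚ)) =
      evalNat lam.parts.toFinset := by
    refine MvPolynomial.algHom_ext fun m => ?_
    rw [evalOn_gen, evalOn_gen, ← sum_part h fun a => (a : ℚ) ^ (2 * m + 1)]
    simp only [MvPolynomial.aeval_X]
  rw [h2] at h1
  rw [← h1, value]
  exact (RingHom.congr_fun (MvPolynomial.coe_aeval_eq_eval _) _).symm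

theorem evalNat_eq_of_toFamily_eq {f g : OddRing} (h : toFamily f = toFamily g) {B : Finset ℕ}
    (hB : 0 ∉ B) : evalNat B f = evalNat B g := by
  have hB' : B ∈ strictSets (∑ i ∈ B, i) := mem_strictSets.2 ⟨hB, rfl⟩
  have hf := value_toFamily (ofStrictSet_mem hB') f
  rw [h, value_toFamily (ofStrictSet_mem hB') g, ofStrictSet_toFinset] at hf
  exact hf.symm

/-- The family determines all values at strict partitions, and these separate elements. -/
theorem toFamily_injective : Function.Injective toFamily :=
  fun _ _ h => ext_evalNat fun _ hB => evalNat_eq_of_toFamily_eq h hB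

/-! ### The symmetrization formula -/

theorem evalOn_schur_of_card_lt {ι K : Type*} [DecidableEq ι] [Field K] [Algebra ℚ K]
    {fs : List (Polynomial ℚ)} (hfs : ∀ f ∈ fs, f.coeff 0 = 0) {A : Finset ι} {x : ι → K}
    (hx : Set.InjOn x A) (h : A.card < fs.length) : evalOn A x (schur fs) = 0 := by
  induction fs generalizing A with
  | nil => simp at h
  | cons f fs ih =>
    rw [schur_cons, evalOn_cons A x hx (hfs f (by simp))]
    refine Finset.sum_eq_zero fun i hi => ?_
    rw [ih (fun g hg => hfs g (by simp [hg])) (hx.mono (by simp)), mul_zero]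
    have := Finset.card_erase_add_one hi
    rw [List.length_cons] at h
    omega

/-- The embedding of `Fin M` into `Fin (M + 1)` that misses `p`. -/
def skip {M : ℕ} (p : Fin (M + 1)) : Fin M ↪ Fin (M + 1) :=
  (Fin.succEmb M).trans (Equiv.swap 0 p).toEmbedding

theorem skip_apply {M : ℕ} (p : Fin (M + 1)) (j : Fin M) : skip p j = Equiv.swap 0 p j.succ := rfl

theorem erase_eq_map_skip {M : ℕ} (p : Fin (M + 1)) :
    Finset.univ.erase p = Finset.univ.map (skip p) := by
  ext k
  simp only [Finset.mem_erase, Finset.mem_univ, and_true, Finset.mem_map, true_and, skip_apply]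
  constructor
  · intro hk
    have : Equiv.swap 0 p k ≠ 0 := fun h => hk (by
      rw [Equiv.swap_apply_eq_iff, Equiv.swap_apply_left] at h; exact h)
    obtain ⟨j, hj⟩ := Fin.exists_succ_eq.2 this
    exact ⟨j, by rw [hj, Equiv.swap_apply_self]⟩
  · rintro ⟨j, rfl⟩ h
    rw [Equiv.swap_apply_eq_iff, Equiv.swap_apply_right] at h
    exact Fin.succ_ne_zero j h

theorem evalOn_skip {K : Type*} [Field K] [Algebra ℚ K] {M : ℕ} (x : Fin (M + 1) → K)
    (p : Fin (M + 1)) (f : OddRing) :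
    evalOn Finset.univ (x ∘ skip p) f = evalOn (Finset.univ.erase p) x f := by
  refine DFunLike.congr_fun (MvPolynomial.algHom_ext fun m => ?_) f
  rw [evalOn_gen, evalOn_gen, erase_eq_map_skip, Finset.sum_map]
  rfl

/-- The summand of the symmetrization formula. -/
noncomputable def symTerm {K : Type*} [Field K] (L : List ℕ) (b : K → ℕ → K) {N : ℕ}
    (x : Fin N → K) : K :=
  (∏ i ∈ Finset.univ.filter (fun i : Fin N => (i : ℕ) < L.length), b (x i) (L.getD i 0)) *
    ∏ i ∈ Finset.univ.filter (fun i : Fin N => (i : ℕ) < L.length),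
      ∏ j ∈ Finset.univ.filter (fun j : Fin N => i < j), (x i + x j) / (x i - x j)

theorem symTerm_cons {K : Type*} [Field K] (m : ℕ) (L : List ℕ) (b : K → ℕ → K) {M : ℕ}
    (x : Fin (M + 1) → K) :
    symTerm (m :: L) b x = b (x 0) m * (∏ j : Fin M, (x 0 + x j.succ) / (x 0 - x j.succ)) *
      symTerm L b (x ∘ Fin.succ) := by
  simp only [symTerm, Finset.prod_filter, Fin.prod_univ_succ, List.length_cons, Fin.val_zero,
    Fin.val_succ, List.getD_cons_zero, List.getD_cons_succ, Nat.zero_lt_succ, if_true,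
    Nat.add_lt_add_iff_right, if_false, one_mul, Fin.succ_pos,
    Fin.succ_lt_succ_iff, Function.comp_apply, not_lt_zero]
  ring

/-- Sorting permutations by the image p of the first index reproduces one insertion, at x_p. When L
is exhausted, the permutations of the remaining indices give the factorial. -/
theorem sum_symTerm {K : Type*} [Field K] [Algebra ℚ K] (F : ℕ → Polynomial ℚ) {L : List ℕ}
    (hF : ∀ m ∈ L, (F m).coeff 0 = 0) {N : ℕ} (hN : L.length ≤ N) {x : Fin N → K}
    (hx : Function.Injective x) :
    ∑ ω : Equiv.Perm (Fin N), symTerm L (fun a m => Polynomial.aeval a (F m)) (x ∘ ω) =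
      ((N - L.length).factorial : K) * evalOn Finset.univ x (schur (L.map F)) := by
  induction L generalizing N with
  | nil => simp [symTerm, Fintype.card_perm]
  | cons m L ih =>
    cases N with
    | zero => simp at hN
    | succ M =>
      have hM : L.length ≤ M := by simpa using hN
      rw [← Equiv.sum_comp Equiv.Perm.decomposeFin.symm, Fintype.sum_prod_type, List.map_cons,
        schur_cons, evalOn_cons _ x hx.injOn (hF m (by simp)), Finset.mul_sum]
      refine Finset.sum_congr rfl fun p _ => ?_
      have h1 : ∀ e : Equiv.Perm (Fin M), symTerm (m :: L) (fun a m => Polynomial.aeval a (F m))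
          (x ∘ Equiv.Perm.decomposeFin.symm (p, e)) =
          Polynomial.aeval (x p) (F m) * crossFactor Finset.univ x p *
            symTerm L (fun a m => Polynomial.aeval a (F m)) ((x ∘ skip p) ∘ e) := by
        intro e
        have h2 : (x ∘ Equiv.Perm.decomposeFin.symm (p, e)) ∘ Fin.succ = (x ∘ skip p) ∘ e := by
          funext j
          simp [skip_apply, Equiv.Perm.decomposeFin_symm_apply_succ]
        rw [symTerm_cons, h2]
        congr 2
        · simp
        · rw [crossFactor, erase_eq_map_skip, Finset.prod_map,
            ← Equiv.prod_comp e fun j => (x p + x (skip p j)) / (x p - x (skip p j))]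
          refine Finset.prod_congr rfl fun j _ => ?_
          have h3 := congrFun h2 j
          simp only [Function.comp_apply] at h3
          simp only [Function.comp_apply, h3, Equiv.Perm.decomposeFin_symm_apply_zero]
      rw [Finset.sum_congr rfl fun e _ => h1 e, ← Finset.mul_sum,
        ih (fun k hk => hF k (by simp [hk])) hM (hx.comp (skip p).injective), evalOn_skip,
        List.length_cons, Nat.add_sub_add_right]
      ring

theorem var_injective {N : ℕ} : Function.Injective (var : Fin N → _) :=
  (IsFractionRing.injective (MvPolynomial (Fin N) ℚ) _).comp (MvPolynomial.X_injective)

theorem algebraMap_toFamily_schur {n : ℕ} {lam : n.Partition}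
    (h : lam ∈ Nat.Partition.distincts n) (F : ℕ → Polynomial ℚ)
    (hF : ∀ m, m ≠ 0 → (F m).coeff 0 = 0) (N : ℕ) :
    algebraMap (MvPolynomial (Fin N) ℚ) (FractionRing (MvPolynomial (Fin N) ℚ))
      (toFamily (schur ((decr lam.parts.toFinset).map F)) N) =
    symmetrization lam N fun x m => Polynomial.aeval x (F m) := by
  have hpos : ∀ m ∈ row lam, (F m).coeff 0 = 0 := fun m hm =>
    hF m (lam.parts_pos ((Multiset.mem_sort _).1 hm)).ne'
  have h1 := map_toFamily (IsScalarTower.toAlgHom ℚ (MvPolynomial (Fin N) ℚ)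
    (FractionRing (MvPolynomial (Fin N) ℚ))) (schur ((decr lam.parts.toFinset).map F))
  rw [← row_eq h] at h1 ⊢
  refine h1.trans ?_
  change evalOn Finset.univ var (schur ((row lam).map F)) = _
  rw [symmetrization, ← row_length]
  split_ifs with hN
  · have h2 := sum_symTerm F hpos hN (var_injective (N := N))
    have : CharZero (FractionRing (MvPolynomial (Fin N) ℚ)) := algebraRat.charZero _
    rw [eq_inv_mul_iff_mul_eq₀ (by exact_mod_cast Nat.factorial_ne_zero _), ← h2]
    rfl
  · refine evalOn_schur_of_card_lt ?_ var_injective.injOn (by simpa using hN)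
    intro f hf
    obtain ⟨m, hm, rfl⟩ := List.mem_map.1 hf
    exact hpos m hm

theorem isSchurP_toFamily {n : ℕ} {lam : n.Partition} (h : lam ∈ Nat.Partition.distincts n) :
    IsSchurP lam (toFamily (schurP lam.parts.toFinset)) := by
  intro N
  have := algebraMap_toFamily_schur h (fun m => Polynomial.X ^ m)
    (fun m hm => by simp [Polynomial.coeff_X_pow, hm.symm]) N
  simp only [map_pow, Polynomial.aeval_X] at this
  exact this

theorem isFactorialSchurP_toFamily {n : ℕ} {lam : n.Partition}
    (h : lam ∈ Nat.Partition.distincts n) :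
    IsFactorialSchurP lam (toFamily (factP lam.parts.toFinset)) := by
  intro N
  have h1 := algebraMap_toFamily_schur h (descPochhammer ℚ)
    (fun m hm => descPochhammer_coeff_zero hm) N
  have h2 : ∀ (x : FractionRing (MvPolynomial (Fin N) ℚ)) (m : ℕ),
      Polynomial.aeval x (descPochhammer ℚ m) = ∏ j ∈ Finset.range m, (x - j) := by
    intro x m
    rw [← descPochhammer_eval_eq_prod_range, Polynomial.aeval_def, ← Polynomial.eval_map,
      descPochhammer_map]
  simp only [h2] at h1
  exact h1

theorem isSchurP_unique {n : ℕ} {lam : n.Partition} {F G : PolyFamily} (hF : IsSchurP lam F)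
    (hG : IsSchurP lam G) : F = G :=
  funext fun N => IsFractionRing.injective _ _ ((hF N).trans (hG N).symm)

theorem isFactorialSchurP_unique {n : ℕ} {lam : n.Partition} {F G : PolyFamily}
    (hF : IsFactorialSchurP lam F) (hG : IsFactorialSchurP lam G) : F = G :=
  funext fun N => IsFractionRing.injective _ _ ((hF N).trans (hG N).symm)

/-- `Γ` is the polynomial ring on the odd power sums. -/
noncomputable def gammaEquiv : OddRing ≃ₐ[ℚ] Gamma :=
  (AlgEquiv.ofInjective toFamily toFamily_injective).trans (Subalgebra.equivOfEq _ _ toFamily_range)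

theorem coe_gammaEquiv (f : OddRing) : (gammaEquiv f : PolyFamily) = toFamily f := rfl

/-! ### Shifted diagrams and standard tableaux -/

/-- The shifted diagram with row lengths `p 0, p 1, …`. -/
def rowDiagram (p : ℕ → ℕ) : Set (ℕ × ℕ) :=
  {b | 1 ≤ b.1 ∧ b.1 ≤ b.2 ∧ b.2 < p (b.1 - 1) + b.1}

theorem mem_rowDiagram {p : ℕ → ℕ} {i t : ℕ} : (i + 1, i + 1 + t) ∈ rowDiagram p ↔ t < p i := by
  simp only [rowDiagram, Set.mem_ofPred_eq, Nat.add_sub_cancel]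
  omega

/-- Each row of a diagram is an initial interval, so one extra box must lengthen one row by one. -/
theorem rowDiagram_insert_iff {p q : ℕ → ℕ} :
    (∃ b ∉ rowDiagram p, rowDiagram q = insert b (rowDiagram p)) ↔
      ∃ r, q = Function.update p r (p r + 1) := by
  constructor
  · rintro ⟨⟨a, c⟩, hb, h⟩
    have hq : (a, c) ∈ rowDiagram q := h ▸ Set.mem_insert _ _
    obtain ⟨r, rfl⟩ : ∃ r, a = r + 1 := ⟨a - 1, by have := hq.1; simp only at this; omega⟩
    obtain ⟨t₀, rfl⟩ : ∃ t, c = r + 1 + t := ⟨c - (r + 1), by have := hq.2.1; simp only at this; omega⟩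
    have key : ∀ i t, t < q i ↔ (i = r ∧ t = t₀) ∨ t < p i := by
      intro i t
      rw [← mem_rowDiagram, h, Set.mem_insert_iff, mem_rowDiagram, Prod.mk.injEq]
      refine or_congr_left ?_
      omega
    rw [mem_rowDiagram] at hb
    refine ⟨r, funext fun i => ?_⟩
    rcases eq_or_ne i r with rfl | hi
    · rw [Function.update_self]
      -- Testing at t₀, p i and p i + 1 forces t₀ = p i and q i = p i + 1.
      have h1 := key i t₀
      have h2 := key i (p i)
      have h3 := key i (p i + 1)
      omega
    · rw [Function.update_of_ne hi]
      have h1 := key i (p i)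
      have h2 := key i (q i)
      omega
  · rintro ⟨r, rfl⟩
    refine ⟨(r + 1, r + 1 + p r), by rw [mem_rowDiagram]; omega, ?_⟩
    ext ⟨a, c⟩
    simp only [Set.mem_insert_iff, rowDiagram, Set.mem_ofPred_eq, Prod.mk.injEq]
    rcases eq_or_ne (a - 1) r with rfl | h
    · rw [Function.update_self]; omega
    · rw [Function.update_of_ne h]; omega

/-- The `i`-th largest element of a finite set, or `0`. -/
def rowLength (A : Finset ℕ) (i : ℕ) : ℕ := (decr A).getD i 0

theorem rowLength_mem {A : Finset ℕ} {k : ℕ} (hk : k ≠ 0) : k ∈ A ↔ ∃ s, rowLength A s = k := by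
  rw [← mem_decr, List.mem_iff_getElem]
  constructor
  · rintro ⟨s, hs, rfl⟩
    exact ⟨s, List.getD_eq_getElem _ _ hs⟩
  · rintro ⟨s, rfl⟩
    rcases lt_or_ge s (decr A).length with hs | hs
    · exact ⟨s, hs, (List.getD_eq_getElem _ _ hs).symm⟩
    · exact absurd (List.getD_eq_default _ _ hs) hk

theorem rowLength_injective {A : Finset ℕ} {s t : ℕ} (h : rowLength A s = rowLength A t)
    (h0 : rowLength A s ≠ 0) : s = t := by
  have hlt : ∀ s, rowLength A s ≠ 0 → s < (decr A).length := fun s hs => by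
    by_contra hge
    exact hs (List.getD_eq_default _ _ (not_lt.1 hge))
  have hs := hlt s h0
  have ht := hlt t (h ▸ h0)
  rw [rowLength, rowLength, List.getD_eq_getElem _ _ hs, List.getD_eq_getElem _ _ ht] at h
  exact (decr_nodup A).getElem_inj_iff.1 h

theorem rowLength_update_iff {A B : Finset ℕ} (hA : 0 ∉ A) (hB : 0 ∉ B) :
    (∃ r, rowLength B = Function.update (rowLength A) r (rowLength A r + 1)) ↔
      ∃ i ∈ addable A, B = addBox A i := by
  constructor
  · rintro ⟨r, h⟩
    have hr : rowLength B r = rowLength A r + 1 := by rw [h, Function.update_self]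
    have hs : ∀ s, s ≠ r → rowLength B s = rowLength A s := fun s hs => by
      rw [h, Function.update_of_ne hs]
    refine ⟨rowLength A r, mem_addable.2 ⟨?_, fun hmem => ?_⟩, ?_⟩
    · by_cases h0 : rowLength A r = 0
      · exact Or.inl h0
      · exact Or.inr ((rowLength_mem h0).2 ⟨r, rfl⟩)
    · obtain ⟨s, hs'⟩ := (rowLength_mem (by simp)).1 hmem
      have hsr : s ≠ r := by rintro rfl; omega
      exact hsr (rowLength_injective (A := B) (by rw [hs s hsr, hs', hr])
        (by rw [hs s hsr, hs']; simp))
    · ext k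
      simp only [addBox, Finset.mem_insert, Finset.mem_erase]
      rcases eq_or_ne k 0 with rfl | hk
      · simp [hA, hB]
      rw [rowLength_mem hk, rowLength_mem hk]
      constructor
      · rintro ⟨s, hsk⟩
        rcases eq_or_ne s r with rfl | hsr
        · exact Or.inl (by rw [← hsk, hr])
        · rw [hs s hsr] at hsk
          refine Or.inr ⟨fun h => hsr ?_, s, hsk⟩
          exact rowLength_injective (by rw [hsk, h]) (by rwa [hsk])
      · rintro (rfl | ⟨hne, s, hsk⟩)
        · exact ⟨r, hr⟩
        · have hsr : s ≠ r := by rintro rfl; exact hne hsk.symm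
          exact ⟨s, by rw [hs s hsr, hsk]⟩
  · rintro ⟨i, hi, rfl⟩
    obtain ⟨hi, hi1⟩ := mem_addable.1 hi
    rcases eq_or_ne i 0 with rfl | hi0
    · refine ⟨(decr A).length, funext fun s => ?_⟩
      have h1 : decr (addBox A 0) = decr A ++ [1] := by
        rw [addBox, Finset.erase_eq_of_notMem hA]
        exact decr_append_one hA hi1
      have h2 : rowLength A (decr A).length = 0 := List.getD_eq_default _ _ le_rfl
      rw [h2]
      rcases lt_trichotomy s (decr A).length with hs | rfl | hs
      · rw [Function.update_of_ne hs.ne, rowLength, h1, List.getD_append _ _ _ _ hs, rowLength]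
      · rw [Function.update_self, rowLength, h1, List.getD_append_right _ _ _ _ le_rfl]
        simp
      · rw [Function.update_of_ne hs.ne', rowLength, h1, List.getD_eq_default _ _ (by simpa using hs),
          rowLength, List.getD_eq_default _ _ hs.le]
    · have hiA : i ∈ A := hi.resolve_left hi0
      obtain ⟨r, hr⟩ := (rowLength_mem hi0).1 hiA
      refine ⟨r, funext fun s => ?_⟩
      have h1 : decr (addBox A i) = (decr A).map (Function.update id i (i + 1)) :=
        decr_replace hiA (fun j hj hij => lt_of_le_of_ne hij fun h' => hi1 (by rwa [← h'] at hj))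
          (fun j _ hji => Nat.lt_succ_of_lt hji)
      have h2 : rowLength (addBox A i) s = Function.update id i (i + 1) (rowLength A s) := by
        have h3 : Function.update id i (i + 1) 0 = 0 := by
          rw [Function.update_of_ne hi0.symm]; rfl
        have h4 := List.getD_map (l := decr A) (d := 0) (n := s) (Function.update id i (i + 1))
        rw [h3] at h4
        rw [rowLength, h1, rowLength, h4]
      rw [h2]
      rcases eq_or_ne s r with rfl | hsr
      · rw [Function.update_self, hr, Function.update_self]
      · rw [Function.update_of_ne hsr, Function.update_of_ne, id]
        intro h
        exact hsr (rowLength_injective (by rw [h, hr]) (by rwa [h]))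

theorem shiftedDiagram_eq {n : ℕ} {lam : n.Partition} (h : lam ∈ Nat.Partition.distincts n) :
    shiftedDiagram lam = rowDiagram (rowLength lam.parts.toFinset) := by
  have hp : ∀ i, part lam i = rowLength lam.parts.toFinset i := fun i => by
    rw [part, row_eq h, rowLength]
  have hlen : ∀ i, len lam ≤ i → part lam i = 0 := fun i hi =>
    List.getD_eq_default _ _ (by rwa [row_length])
  ext ⟨a, c⟩
  simp only [shiftedDiagram, rowDiagram, Set.mem_ofPred_eq, ← hp]
  have := hlen (a - 1)
  omega

/-- The diagrams differ by exactly one box. -/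
def Covers {m n : ℕ} (nu : m.Partition) (lam : n.Partition) : Prop :=
  ∃ b ∉ shiftedDiagram nu, shiftedDiagram lam = insert b (shiftedDiagram nu)

theorem zero_notMem_toFinset {n : ℕ} (lam : n.Partition) : 0 ∉ lam.parts.toFinset := fun h =>
  lt_irrefl 0 (lam.parts_pos (Multiset.mem_toFinset.1 h))

/-- Phrased by removal from the larger partition, to match the recursion of `pathCount`. -/
theorem covers_iff {m n : ℕ} {nu : m.Partition} {lam : n.Partition}
    (hn : nu ∈ Nat.Partition.distincts m) (hl : lam ∈ Nat.Partition.distincts n) :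
    Covers nu lam ↔
      ∃ j ∈ removable lam.parts.toFinset, removeBox lam.parts.toFinset j = nu.parts.toFinset := by
  rw [Covers, shiftedDiagram_eq hn, shiftedDiagram_eq hl, rowDiagram_insert_iff,
    rowLength_update_iff (zero_notMem_toFinset nu) (zero_notMem_toFinset lam)]
  have h0 := zero_notMem_toFinset lam
  constructor
  · rintro ⟨i, hi, h⟩
    rw [h]
    exact ⟨i + 1, succ_mem_removable _ i, removeBox_addBox (zero_notMem_toFinset nu) hi⟩
  · rintro ⟨j, hj, h⟩
    rw [← h]
    exact ⟨j - 1, pred_mem_addable h0 hj, (addBox_removeBox h0 hj).symm⟩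

theorem removeBox_injOn {B : Finset ℕ} (hB : 0 ∉ B) : Set.InjOn (removeBox B) (removable B) := by
  intro j hj k hk h
  obtain ⟨hj, hj1⟩ := mem_removable.1 hj
  by_contra hjk
  have hj0 : j ≠ 0 := by rintro rfl; exact hB hj
  have h1 : j ∈ removeBox B k := by
    simp only [removeBox, Finset.mem_erase, Finset.mem_insert]
    exact ⟨hj0, Or.inr ⟨hjk, hj⟩⟩
  rw [← h] at h1
  simp only [removeBox, Finset.mem_erase, Finset.mem_insert] at h1
  omega

/-- Removal of the last partition of a sequence. -/
def dropLast {n : ℕ} (c : (i : Fin (n + 2)) → Nat.Partition (i : ℕ)) :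
    (i : Fin (n + 1)) → Nat.Partition (i : ℕ) := fun i => c i.castSucc

theorem dropLast_mem_distincts {n : ℕ} {lam : (n + 1).Partition}
    {c : (i : Fin (n + 2)) → Nat.Partition (i : ℕ)} (hc : c ∈ standardTableaux lam)
    (i : Fin (n + 1)) : dropLast c i ∈ Nat.Partition.distincts (i : ℕ) := hc.1 i.castSucc

theorem dropLast_covers {n : ℕ} {lam : (n + 1).Partition}
    {c : (i : Fin (n + 2)) → Nat.Partition (i : ℕ)} (hc : c ∈ standardTableaux lam) :
    Covers (dropLast c (Fin.last n)) lam := by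
  have h := hc.2.2 (Fin.last n)
  have h' : Covers (c (Fin.last n).castSucc) (c (Fin.last n).succ) := h
  have e : c (Fin.last n).succ = lam := hc.2.1
  rw [e] at h'
  exact h'

theorem dropLast_mem {n : ℕ} {lam : (n + 1).Partition}
    {c : (i : Fin (n + 2)) → Nat.Partition (i : ℕ)} (hc : c ∈ standardTableaux lam) :
    dropLast c ∈ standardTableaux (n := n) (dropLast c (Fin.last n)) :=
  ⟨dropLast_mem_distincts hc, rfl, fun i => hc.2.2 i.castSucc⟩

/-- Addition of a last partition to a sequence. -/
def addLast {n : ℕ} (c : (i : Fin (n + 1)) → Nat.Partition (i : ℕ)) (lam : (n + 1).Partition) :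
    (i : Fin (n + 2)) → Nat.Partition (i : ℕ) :=
  Fin.snoc (α := fun i : Fin (n + 2) => Nat.Partition (i : ℕ)) c lam

theorem addLast_castSucc {n : ℕ} (c : (i : Fin (n + 1)) → Nat.Partition (i : ℕ))
    (lam : (n + 1).Partition) (i : Fin (n + 1)) : addLast c lam i.castSucc = c i :=
  Fin.snoc_castSucc (α := fun i : Fin (n + 2) => Nat.Partition (i : ℕ)) _ _ _

theorem addLast_last {n : ℕ} (c : (i : Fin (n + 1)) → Nat.Partition (i : ℕ))
    (lam : (n + 1).Partition) : addLast c lam (Fin.last (n + 1)) = lam :=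
  Fin.snoc_last (α := fun i : Fin (n + 2) => Nat.Partition (i : ℕ)) _ _

theorem dropLast_addLast {n : ℕ} (c : (i : Fin (n + 1)) → Nat.Partition (i : ℕ))
    (lam : (n + 1).Partition) : dropLast (addLast c lam) = c :=
  funext fun i => addLast_castSucc c lam i

theorem addLast_dropLast {n : ℕ} (c : (i : Fin (n + 2)) → Nat.Partition (i : ℕ))
    {lam : (n + 1).Partition} (h : c (Fin.last (n + 1)) = lam) : addLast (dropLast c) lam = c := by
  subst h
  exact Fin.snoc_init_self (α := fun i : Fin (n + 2) => Nat.Partition (i : ℕ)) c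

theorem addLast_mem {n : ℕ} {lam : (n + 1).Partition}
    (h : lam ∈ Nat.Partition.distincts (n + 1)) {nu : n.Partition} (hcov : Covers nu lam)
    {c : (i : Fin (n + 1)) → Nat.Partition (i : ℕ)} (hc : c ∈ standardTableaux nu) :
    addLast c lam ∈ standardTableaux lam := by
  have hlast : c (Fin.last n) = nu := hc.2.1
  subst hlast
  refine ⟨fun i => ?_, addLast_last c lam, fun i => ?_⟩
  · induction i using Fin.lastCases with
    | last => rw [addLast_last]; exact h
    | cast i => rw [addLast_castSucc]; exact hc.1 i
  · change Covers (addLast c lam i.castSucc) (addLast c lam i.succ)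
    rw [addLast_castSucc]
    induction i using Fin.lastCases with
    | last =>
      have e : addLast c lam (Fin.last n).succ = lam := addLast_last c lam
      rw [e]
      exact hcov
    | cast i =>
      have e : addLast c lam i.castSucc.succ = c i.succ := addLast_castSucc c lam i.succ
      rw [e]
      exact hc.2.2 i

/-- Removal of the last step of a standard tableau. -/
noncomputable def standardTableauxEquiv {n : ℕ} {lam : (n + 1).Partition}
    (h : lam ∈ Nat.Partition.distincts (n + 1)) :
    standardTableaux lam ≃
      Σ nu : {nu : n.Partition // nu ∈ Nat.Partition.distincts n ∧ Covers nu lam},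
        standardTableaux nu.1 where
  toFun c := ⟨⟨dropLast c.1 (Fin.last n), dropLast_mem_distincts c.2 (Fin.last n),
    dropLast_covers c.2⟩, ⟨dropLast c.1, dropLast_mem c.2⟩⟩
  invFun p := ⟨addLast p.2.1 lam, addLast_mem h p.1.2.2 p.2.2⟩
  left_inv c := Subtype.ext (addLast_dropLast c.1 c.2.2.1)
  right_inv p := by
    have h1 : dropLast (addLast p.2.1 lam) = p.2.1 := dropLast_addLast _ _
    refine Sigma.subtype_ext (Subtype.ext ?_) h1
    exact (congrFun h1 (Fin.last n)).trans p.2.2.2.1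

theorem tableauCount_succ {n : ℕ} {lam : (n + 1).Partition}
    (h : lam ∈ Nat.Partition.distincts (n + 1)) [DecidablePred fun nu : n.Partition => Covers nu lam] :
    tableauCount lam =
      ∑ nu ∈ (Nat.Partition.distincts n).filter fun nu => Covers nu lam, tableauCount nu := by
  rw [tableauCount, ← Nat.card_coe_set_eq, Nat.card_congr (standardTableauxEquiv h), Nat.card_sigma]
  simp only [tableauCount, ← Nat.card_coe_set_eq]
  exact (Finset.sum_subtype _ (fun nu => Finset.mem_filter)
    fun nu => Nat.card (standardTableaux nu)).symm

theorem tableauCount_eq {n : ℕ} {lam : n.Partition} (h : lam ∈ Nat.Partition.distincts n) :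
    tableauCount lam = pathCount n lam.parts.toFinset := by
  classical
  induction n with
  | zero =>
    rw [tableauCount, pathCount, Set.ncard_eq_one]
    refine ⟨fun i => Fin.cases (motive := fun i : Fin 1 => Nat.Partition (i : ℕ)) lam
      (fun i => i.elim0) i, Set.eq_singleton_iff_unique_mem.2 ⟨⟨fun i => ?_, ?_, fun i => i.elim0⟩,
      fun c hc => funext fun i => ?_⟩⟩
    · induction i using Fin.cases with
      | zero => exact h
      | succ i => exact i.elim0
    · rfl
    · induction i using Fin.cases with
      | zero => exact hc.2.1
      | succ i => exact i.elim0
  | succ n ih =>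
    have h0 := zero_notMem_toFinset lam
    have hl := toFinset_mem_strictSets h
    rw [tableauCount_succ h, pathCount, Finset.sum_congr rfl fun nu hnu =>
      ih (Finset.mem_filter.1 hnu).1, ← Finset.sum_image (f := pathCount n) (removeBox_injOn h0)]
    refine Finset.sum_bij (fun nu _ => nu.parts.toFinset) ?_ ?_ ?_ fun _ _ => rfl
    · intro nu hnu
      obtain ⟨h1, h2⟩ := Finset.mem_filter.1 hnu
      exact Finset.mem_image.2 ((covers_iff h1 h).1 h2)
    · intro nu hnu mu hmu heq
      exact toFinset_injOn (Finset.mem_filter.1 hnu).1 (Finset.mem_filter.1 hmu).1 heq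
    · intro A hA
      obtain ⟨j, hj, rfl⟩ := Finset.mem_image.1 hA
      have h1 := removeBox_mem hl hj
      refine ⟨ofStrictSet h1, Finset.mem_filter.2 ⟨ofStrictSet_mem h1, ?_⟩, ofStrictSet_toFinset h1⟩
      exact (covers_iff (ofStrictSet_mem h1) h).2 ⟨j, hj, (ofStrictSet_toFinset h1).symm⟩

/-! ### The main result -/

theorem average_toFamily (n : ℕ) (f : OddRing) :
    average n (fun lam => value (toFamily f) lam) = plancherelAverage n f := by
  rw [plancherelAverage_apply, ← sum_distincts, average]
  refine Finset.sum_congr rfl fun lam hlam => ?_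
  rw [value_toFamily hlam, shiftedPlancherel, tableauCount_eq hlam, pathWeight, len]
  rw [Multiset.toFinset_card_of_nodup (mem_distincts.1 hlam)]
  ring

theorem powerSumProd_eq {k : ℕ} {rho : k.Partition} (h : rho ∈ Nat.Partition.odds k) :
    powerSumProd rho = toFamily (genProd (rho.parts.map fun r => r / 2)) := by
  have h1 : ∀ i ∈ rho.parts, ¬ Even i := by
    simpa [Nat.Partition.odds, Nat.Partition.restricted] using h
  rw [powerSumProd, genProd, Multiset.map_map, map_multiset_prod, Multiset.map_map]
  congr 1
  refine Multiset.map_congr rfl fun r hr => ?_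
  obtain ⟨m, rfl⟩ := Nat.not_even_iff_odd.1 (h1 r hr)
  simp only [Function.comp_apply, toFamily, MvPolynomial.aeval_X]
  congr 1
  omega

theorem parts_eq_replicate_iff {k : ℕ} {rho : k.Partition} (h : rho ∈ Nat.Partition.odds k) :
    rho.parts.map (fun r => r / 2) = Multiset.replicate rho.parts.card 0 ↔
      rho.parts = Multiset.replicate k 1 := by
  have h1 : ∀ i ∈ rho.parts, ¬ Even i := by
    simpa [Nat.Partition.odds, Nat.Partition.restricted] using h
  constructor
  · intro hr
    have h2 : rho.parts = Multiset.replicate rho.parts.card 1 := by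
      refine Multiset.eq_replicate.2 ⟨rfl, fun r hmem => ?_⟩
      have h3 : r / 2 = 0 := Multiset.eq_of_mem_replicate (hr ▸ Multiset.mem_map_of_mem _ hmem)
      obtain ⟨m, rfl⟩ := Nat.not_even_iff_odd.1 (h1 r hmem)
      omega
    have h3 := rho.parts_sum
    rw [h2] at h3
    have h4 : rho.parts.card = k := by simpa using h3
    rwa [h4] at h2
  · intro hr
    simp [hr]

/-- The isomorphism `Ψ` on `Γ`. -/
noncomputable def gammaFactorize : Gamma ≃ₗ[ℚ] Gamma :=
  (gammaEquiv.toLinearEquiv.symm.trans factorize).trans gammaEquiv.toLinearEquiv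

theorem gammaFactorize_apply (f : OddRing) :
    gammaFactorize (gammaEquiv f) = gammaEquiv (factorize f) := by
  simp [gammaFactorize]

theorem sendsSchurPToFactorial_gammaFactorize : SendsSchurPToFactorial gammaFactorize :=
  fun _ lam h => ⟨gammaEquiv (schurP lam.parts.toFinset), gammaEquiv (factP lam.parts.toFinset),
    isSchurP_toFamily h, isFactorialSchurP_toFamily h, by
      rw [gammaFactorize_apply, factorize_schurP (zero_notMem_toFinset lam)]⟩

/-- The P_λ span, and the symmetrization formula determines the families P_λ and P*_λ. -/
theorem SendsSchurPToFactorial.eq_gammaFactorize {Ψ : Gamma ≃ₗ[ℚ] Gamma}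
    (h : SendsSchurPToFactorial Ψ) : Ψ = gammaFactorize := by
  have key : ∀ f : OddRing, Ψ (gammaEquiv f) = gammaFactorize (gammaEquiv f) := by
    intro f
    have hf : f ∈ Submodule.span ℚ {f | ∃ A : Finset ℕ, 0 ∉ A ∧ f = schurP A} := by
      rw [span_schurP]; trivial
    induction hf using Submodule.span_induction with
    | mem x hx =>
      obtain ⟨A, hA, rfl⟩ := hx
      have hA' : A ∈ strictSets (∑ i ∈ A, i) := mem_strictSets.2 ⟨hA, rfl⟩
      have hd := ofStrictSet_mem hA'
      obtain ⟨F, G, hF, hG, hΨ⟩ := h _ _ hd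
      have h1 := isSchurP_toFamily hd
      have h2 := isFactorialSchurP_toFamily hd
      rw [ofStrictSet_toFinset] at h1 h2
      have h3 : F = gammaEquiv (schurP A) := Subtype.ext (isSchurP_unique hF h1)
      have h4 : G = gammaEquiv (factP A) := Subtype.ext (isFactorialSchurP_unique hG h2)
      rw [gammaFactorize_apply, factorize_schurP hA, ← h3, ← h4, hΨ]
    | zero => simp
    | add x y _ _ hx hy => simp only [map_add, hx, hy]
    | smul c x _ hx => simp only [map_smul, hx]
  refine LinearEquiv.ext fun F => ?_
  obtain ⟨f, rfl⟩ := gammaEquiv.surjective F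
  exact key f

theorem psi_eq : Psi = gammaFactorize :=
  SendsSchurPToFactorial.eq_gammaFactorize
    (Classical.epsilon_spec ⟨gammaFactorize, sendsSchurPToFactorial_gammaFactorize⟩)

end ShiftedPlancherel

theorem corollary4p3 :
    -- the isomorphism that defines the functions `𝔭_ρ` exists and is unique
    (∃! Ψ : ShiftedPlancherel.Gamma ≃ₗ[ℚ] ShiftedPlancherel.Gamma,
      ShiftedPlancherel.SendsSchurPToFactorial Ψ) ∧
    ∀ (k : ℕ) (rho : k.Partition) (h : rho ∈ Nat.Partition.odds k) (n : ℕ),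
      ShiftedPlancherel.average n
          (fun lam => ShiftedPlancherel.value (ShiftedPlancherel.frakP rho h) lam) =
        if rho.parts = Multiset.replicate k 1 then (n.descFactorial k : ℚ) else 0 := by
  open ShiftedPlancherel in
  refine ⟨⟨gammaFactorize, sendsSchurPToFactorial_gammaFactorize,
    fun _ h => h.eq_gammaFactorize⟩, fun k rho h n => ?_⟩
  have h1 : frakP rho h = gammaEquiv (factorize (genProd (rho.parts.map fun r => r / 2))) := by
    rw [frakP, psi_eq, ← gammaFactorize_apply]
    exact congrArg gammaFactorize (Subtype.ext (powerSumProd_eq h))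
  simp only [h1, coe_gammaEquiv]
  rw [average_toFamily, plancherelAverage_factorize_genProd, Multiset.card_map]
  by_cases hr : rho.parts = Multiset.replicate k 1
  · rw [if_pos ((parts_eq_replicate_iff h).2 hr), if_pos hr]
    conv_lhs => rw [hr, Multiset.card_replicate]
  · rw [if_neg (fun h' => hr ((parts_eq_replicate_iff h).1 h')), if_neg hr]
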